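/- Let $U_q(\mathfrak{sl}_2)$ be the algebra over $\mathbb{C}(q^{1/4})$ generated by $E$, $F$ and $K_w$ for $w$ in the coweight lattice $\mathbb{Z}\cdot\tfrac12 H$, with $K_0=1$, $K_{w+w'}=K_wK_{w'}$, $K_wE=q^{\langle w,\alpha\rangle}EK_w$, $K_wF=q^{-\langle w,\alpha\rangle}FK_w$, $EF-FE=\frac{K-K^{-1}}{q-q^{-1}}$, where $K=K_H$, and with $$\Delta E=E\otimes K+1\otimes E,\quad \Delta F=F\otimes 1+K^{-1}\otimes F,\quad \Delta K_w=K_w\otimes K_w,\qquad S(E)=-EK^{-1},\quad S(F)=-KF,\quad S(K_w)=K_{-w}.$$ Let $\omega=\rho$ be the fundamental weight, so that $(\omega,\omega)=\tfrac12$, and for $\lambda=n\omega$, $n\ge 0$, let $V_\lambda$ be the irreducible type 1 representation of highest weight $\lambda$. Let $\widetilde{U}=\prod_\lambda \mathrm{End}(V_\lambda)$ be the completion of $U_q(\mathfrak{sl}_2)$; its elements act on all finite-dimensional type 1 representations, and $\widetilde{U\otimes U}=\prod_{\lambda,\mu}\mathrm{End}(V_\lambda\otimes V_\mu)$. In $\widetilde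 U$ let $C$ act on $V_\lambda$ by the scalar $q^{-(\lambda,\lambda)-2(\lambda,\rho)}$, let $J$ act on vectors of weight $\mu$ by $q^{(\mu,\mu)/2+(\mu,\rho)}$, let $T$ act on a vector $v$ of weight $m\omega$ by $$T v=\sum_{a,b,c\ge 0,\ -a+b-c=m}(-1)^b q^{\,b-ac}E^{(a)}F^{(b)}E^{(c)}v ,$$ with divided powers $E^{(a)}=E^a/([a][a-1]\cdots[1])$ and likewise $F^{(b)}$, where $[m]=\frac{q^m-q^{-m}}{q-q^{-1}}$, and put $X=JT$. Let $R=(X^{-1}\otimes X^{-1})\Delta(X)$ be the standard $R$-matrix, and $u=\mu\big((S\otimes \mathrm{id})(R_{21})\big)$, where $\mu$ is multiplication. For a finite-dimensional type 1 representation $V$ let $V^*$ be the dual space with $(xf)(v)=f(S(x)v)$. A ribbon element $v\in\widetilde U$ gives $g=v^{-1}u$ and the pivotal structure $p_V:V\to V^{**}$, $p_V(x)(f)=f(gx)$. For $V$ absolutely simple, the Frobenius–Schur indicator $\mathrm{FS}_v(V)$ is $0$ if $V\not\cong V^*$; otherwise choose an isomorphism $f:V\to V^*$ of representations, and let $\mathrm{FS}_v(V)$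 be the constant such that $f=\mathrm{FS}_v(V)\, f^*\circ p_V$. **Proposition.** Let $V=V_\omega$ be the standard two-dimensional representation of $U_q(\mathfrak{sl}_2)$, with basis $v_+,v_-$, $Ev_-=v_+$, $Fv_+=v_-$, $Ev_+=Fv_-=0$, $Kv_\pm=q^{\pm1}v_\pm$, and $K_{H/2}v_\pm=q^{\pm1/2}v_\pm$. Then 1. $\mathrm{FS}_C(V)=-1$; 2. $\mathrm{FS}_{X^{-2}}(V)=1$. -/

import Mathlib

open scoped TensorProduct

noncomputable section

namespace QuantumSl2

/-! ### The base field -/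

/-- The base field `ℂ(q)` with a fourth root `q^(1/4)` adjoined, that is `ℂ(s)` with `s⁴ = q`.
All the fractional powers of `q` that occur for `sl₂` are integer powers of `s`. -/
abbrev K4 : Type := RatFunc ℂ

/-- The chosen fourth root `s = q^(1/4)` of `q`. -/
def s : K4 := RatFunc.X

/-- The quantum parameter `q`. -/
def q : K4 := s ^ 4

lemma s_ne_zero : s ≠ 0 := RatFunc.X_ne_zero

lemma q_ne_zero : q ≠ 0 := pow_ne_zero _ s_ne_zero

/-- The quantum integer `[m] = (q^m - q^(-m)) / (q - q⁻¹)`. -/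
def qInt (m : ℤ) : K4 := (q ^ m - q ^ (-m)) / (q - q⁻¹)

/-- The quantum factorial `[a]! = [a] [a-1] ⋯ [2]` (recall `[1] = 1`). -/
def qFactorial (a : ℕ) : K4 := ∏ k ∈ Finset.range a, qInt (k + 1)

/-! ### The quantized enveloping algebra of `sl₂` -/

/-- The generators of `U_q(sl₂)`: `E`, `F`, and `K_w` for `w` in the coweight lattice `ℤ · H/2`;
`K n` stands for `K_w` with `w = n · H/2`. -/
inductive Gen : Type
  | E : Gen
  | F : Gen
  | K : ℤ → Gen

/-- The generator `g` in the free algebra. -/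
abbrev gen (g : Gen) : FreeAlgebra K4 Gen := FreeAlgebra.ι K4 g

/-- The defining relations of `U_q(sl₂)`. For `w = n · H/2` the pairing of `w` with the simple root
is `n`, and `K_H` is `K 2`. -/
inductive Rel : FreeAlgebra K4 Gen → FreeAlgebra K4 Gen → Prop
  | K_zero : Rel (gen (.K 0)) 1
  | K_add (m n : ℤ) : Rel (gen (.K (m + n))) (gen (.K m) * gen (.K n))
  | K_E (n : ℤ) : Rel (gen (.K n) * gen .E) (q ^ n • (gen .E * gen (.K n)))
  | K_F (n : ℤ) : Rel (gen (.K n) * gen .F) (q ^ (-n) • (gen .F * gen (.K n)))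
  | E_F : Rel (gen .E * gen .F - gen .F * gen .E)
      ((q - q⁻¹)⁻¹ • (gen (.K 2) - gen (.K (-2))))

/-- The quantized universal enveloping algebra `U_q(sl₂)`. -/
def Uq : Type := RingQuot Rel

instance : Ring Uq := inferInstanceAs (Ring (RingQuot Rel))

instance : Algebra K4 Uq := inferInstanceAs (Algebra K4 (RingQuot Rel))

namespace Uq

/-- The quotient map from the free algebra. -/
def mk : FreeAlgebra K4 Gen →ₐ[K4] Uq := RingQuot.mkAlgHom K4 Rel

lemma mk_rel {x y : FreeAlgebra K4 Gen} (h : Rel x y) : mk x = mk y :=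
  RingQuot.mkAlgHom_rel K4 h

/-- The image of a generator in `U_q(sl₂)`. -/
def of (g : Gen) : Uq := mk (gen g)

/-- The generator `E`. -/
abbrev E : Uq := of .E

/-- The generator `F`. -/
abbrev F : Uq := of .F

/-- The element `K_w` for `w = n · H/2`; in particular the usual `K = K_H` is `K 2`. -/
abbrev K (n : ℤ) : Uq := of (.K n)

lemma K_zero : K 0 = 1 := by
  simpa [of] using mk_rel Rel.K_zero

lemma K_add (m n : ℤ) : K (m + n) = K m * K n := by
  simpa [of] using mk_rel (Rel.K_add m n)

lemma K_E (n : ℤ) : K n * E = q ^ n • (E * K n) := by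
  simpa [of] using mk_rel (Rel.K_E n)

lemma K_F (n : ℤ) : K n * F = q ^ (-n) • (F * K n) := by
  simpa [of] using mk_rel (Rel.K_F n)

lemma E_F : E * F - F * E = (q - q⁻¹)⁻¹ • (K 2 - K (-2)) := by
  simpa [of] using mk_rel Rel.E_F

/-- An algebra map out of `U_q(sl₂)` is given by images of the generators that satisfy the
relations. -/
def lift {A : Type*} [Ring A] [Algebra K4 A] (e f : A) (k : ℤ → A)
    (h0 : k 0 = 1) (hadd : ∀ m n, k (m + n) = k m * k n)
    (he : ∀ n, k n * e = q ^ n • (e * k n)) (hf : ∀ n, k n * f = q ^ (-n) • (f * k n))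
    (hef : e * f - f * e = (q - q⁻¹)⁻¹ • (k 2 - k (-2))) : Uq →ₐ[K4] A :=
  RingQuot.liftAlgHom K4 ⟨FreeAlgebra.lift K4 (fun g => match g with
    | .E => e
    | .F => f
    | .K n => k n), by
      intro x y h
      cases h with
      | K_zero => simpa using h0
      | K_add m n => simpa using hadd m n
      | K_E n => simpa using he n
      | K_F n => simpa using hf n
      | E_F => simpa using hef⟩

lemma lift_of {A : Type*} [Ring A] [Algebra K4 A] (e f : A) (k : ℤ → A)
    (h0 : k 0 = 1) (hadd : ∀ m n, k (m + n) = k m * k n)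
    (he : ∀ n, k n * e = q ^ n • (e * k n)) (hf : ∀ n, k n * f = q ^ (-n) • (f * k n))
    (hef : e * f - f * e = (q - q⁻¹)⁻¹ • (k 2 - k (-2))) (g : Gen) :
    lift e f k h0 hadd he hf hef (of g) = match g with
      | .E => e
      | .F => f
      | .K n => k n := by
  refine (RingQuot.liftAlgHom_mkAlgHom_apply (S := K4) _ _ _).trans ?_
  rw [FreeAlgebra.lift_ι_apply]

section lift

variable {A : Type*} [Ring A] [Algebra K4 A] (e f : A) (k : ℤ → A)
    (h0 : k 0 = 1) (hadd : ∀ m n, k (m + n) = k m * k n)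
    (he : ∀ n, k n * e = q ^ n • (e * k n)) (hf : ∀ n, k n * f = q ^ (-n) • (f * k n))
    (hef : e * f - f * e = (q - q⁻¹)⁻¹ • (k 2 - k (-2)))

@[simp] lemma lift_E : lift e f k h0 hadd he hf hef E = e := lift_of ..

@[simp] lemma lift_F : lift e f k h0 hadd he hf hef F = f := lift_of ..

@[simp] lemma lift_K (n : ℤ) : lift e f k h0 hadd he hf hef (K n) = k n := lift_of ..

end lift

lemma K_mul_K_neg (n : ℤ) : K n * K (-n) = 1 := by
  rw [← K_add, add_neg_cancel, K_zero]

lemma K_neg_mul_K (n : ℤ) : K (-n) * K n = 1 := by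
  rw [← K_add, neg_add_cancel, K_zero]

lemma K_comm (m n : ℤ) : K m * K n = K n * K m := by
  rw [← K_add, ← K_add, add_comm]

lemma E_K (n : ℤ) : E * K n = q ^ (-n) • (K n * E) := by
  rw [K_E, smul_smul, ← zpow_add₀ q_ne_zero, neg_add_cancel, zpow_zero, one_smul]

lemma F_K (n : ℤ) : F * K n = q ^ n • (K n * F) := by
  rw [K_F, smul_smul, ← zpow_add₀ q_ne_zero, add_neg_cancel, zpow_zero, one_smul]

/-- The coproduct: `Δ E = E ⊗ K + 1 ⊗ E`, `Δ F = F ⊗ 1 + K⁻¹ ⊗ F`, `Δ K_w = K_w ⊗ K_w`. -/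
def comul : Uq →ₐ[K4] Uq ⊗[K4] Uq :=
  lift (E ⊗ₜ K 2 + 1 ⊗ₜ E) (F ⊗ₜ 1 + K (-2) ⊗ₜ F) (fun n => K n ⊗ₜ K n)
    (by rw [K_zero, Algebra.TensorProduct.one_def])
    (fun m n => by rw [K_add, Algebra.TensorProduct.tmul_mul_tmul])
    (fun n => by
      simp only [mul_add, add_mul, Algebra.TensorProduct.tmul_mul_tmul, K_E, K_comm n 2,
        one_mul, mul_one, smul_add, TensorProduct.smul_tmul', TensorProduct.tmul_smul])
    (fun n => by
      simp only [mul_add, add_mul, Algebra.TensorProduct.tmul_mul_tmul, K_F, K_comm n (-2),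
        one_mul, mul_one, smul_add, TensorProduct.smul_tmul', TensorProduct.tmul_smul])
    (by
      have h1 : (E * K (-2)) ⊗ₜ[K4] (K 2 * F) = (K (-2) * E) ⊗ₜ[K4] (F * K 2) := by
        rw [E_K, K_F, TensorProduct.tmul_smul, ← TensorProduct.smul_tmul', smul_smul,
          ← zpow_add₀ q_ne_zero]
        norm_num
      have h2 : (E * F) = F * E + (q - q⁻¹)⁻¹ • (K 2 - K (-2)) := by rw [← E_F]; abel
      simp only [mul_add, add_mul, Algebra.TensorProduct.tmul_mul_tmul, one_mul, mul_one, h1, h2]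
      simp only [TensorProduct.add_tmul, TensorProduct.tmul_add, ← TensorProduct.smul_tmul',
        TensorProduct.tmul_smul, TensorProduct.sub_tmul, TensorProduct.tmul_sub, smul_sub]
      abel)

/-- The antipode, as an algebra map to the opposite algebra: `S E = -E K⁻¹`, `S F = -K F`,
`S K_w = K_(-w)`. -/
def antipodeOp : Uq →ₐ[K4] Uqᵐᵒᵖ :=
  lift (MulOpposite.op (-(E * K (-2)))) (MulOpposite.op (-(K 2 * F)))
    (fun n => MulOpposite.op (K (-n)))
    (by rw [neg_zero, K_zero]; rfl)
    (fun m n => by rw [← MulOpposite.op_mul, ← K_add, neg_add_rev])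
    (fun n => by
      rw [← MulOpposite.op_mul, ← MulOpposite.op_mul, ← MulOpposite.op_smul]
      congr 1
      rw [neg_mul, mul_neg, smul_neg, mul_assoc, K_comm, ← mul_assoc, E_K, ← mul_assoc, neg_neg,
        smul_mul_assoc])
    (fun n => by
      rw [← MulOpposite.op_mul, ← MulOpposite.op_mul, ← MulOpposite.op_smul]
      congr 1
      rw [neg_mul, mul_neg, smul_neg, mul_assoc, F_K, mul_smul_comm, ← mul_assoc, ← mul_assoc,
        K_comm])
    (by
      rw [← MulOpposite.op_mul, ← MulOpposite.op_mul, ← MulOpposite.op_sub,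
        ← MulOpposite.op_sub, ← MulOpposite.op_smul]
      congr 1
      have h1 : -(K 2 * F) * -(E * K (-2)) = F * E := by
        rw [neg_mul_neg]
        calc K 2 * F * (E * K (-2)) = (K 2 * F) * E * K (-2) := by rw [mul_assoc, mul_assoc, mul_assoc]
          _ = F * E * (K 2 * K (-2)) := by
            rw [K_F, smul_mul_assoc, smul_mul_assoc, mul_assoc F, K_E, mul_smul_comm,
              smul_mul_assoc, smul_smul, ← zpow_add₀ q_ne_zero]
            norm_num [mul_assoc]
          _ = F * E := by rw [K_mul_K_neg, mul_one]
      have h2 : -(E * K (-2)) * -(K 2 * F) = E * F := by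
        rw [neg_mul_neg, mul_assoc, ← mul_assoc (K (-2)), K_neg_mul_K, one_mul]
      rw [h1, h2, neg_neg, ← neg_sub, E_F, ← smul_neg, neg_sub])

/-- The antipode `S` of `U_q(sl₂)`. -/
def antipode (x : Uq) : Uq := (antipodeOp x).unop

/-- The divided power `E^(a) = E^a / [a]!`. -/
def Ediv (a : ℕ) : Uq := (qFactorial a)⁻¹ • E ^ a

/-- The divided power `F^(a) = F^a / [a]!`. -/
def Fdiv (a : ℕ) : Uq := (qFactorial a)⁻¹ • F ^ a

end Uq

/-! ### Finite-dimensional type 1 representations -/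

/-- A finite-dimensional type 1 representation: a finite basis of weight vectors exists, where
`K_w` acts on a vector of weight `m · ω` (`ω` the fundamental weight, `m` an integer) by `q^⟨w, m ω⟩`,
which is `q^(n m / 2) = s^(2 n m)` for `w = n · H/2`. -/
structure Rep where
  /-- The underlying vector space. -/
  V : Type
  [addCommGroup : AddCommGroup V]
  [module : Module K4 V]
  /-- The action of `U_q(sl₂)`. -/
  ρ : Uq →ₐ[K4] Module.End K4 V
  exists_weight_basis : ∃ (ι : Type) (_ : Fintype ι) (b : Module.Basis ι K4 V) (wt : ι → ℤ),
    ∀ i n, ρ (Uq.K n) (b i) = s ^ (2 * n * wt i) • b i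

namespace Rep

attribute [instance] Rep.addCommGroup Rep.module

instance (W : Rep) : Module.Finite K4 W.V := by
  obtain ⟨ι, _, b, -⟩ := W.exists_weight_basis
  exact Module.Finite.of_basis b

/-- The homomorphisms of representations. -/
def Hom (W W' : Rep) : Type := {φ : W.V →ₗ[K4] W'.V // ∀ x, φ ∘ₗ W.ρ x = W'.ρ x ∘ₗ φ}

/-- The isomorphisms of representations. -/
def Iso (W W' : Rep) : Type :=
  {φ : W.V ≃ₗ[K4] W'.V // ∀ x, φ.toLinearMap ∘ₗ W.ρ x = W'.ρ x ∘ₗ φ.toLinearMap}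

/-- The tensor product of two representations; `x` acts by `Δ x`. -/
def tensor (W W' : Rep) : Rep where
  V := W.V ⊗[K4] W'.V
  ρ := (Module.endTensorEndAlgHom (R := K4) (A := K4)).comp
    ((Algebra.TensorProduct.map W.ρ W'.ρ).comp Uq.comul)
  exists_weight_basis := by
    obtain ⟨ι, _, b, wt, hb⟩ := W.exists_weight_basis
    obtain ⟨ι', _, b', wt', hb'⟩ := W'.exists_weight_basis
    refine ⟨ι × ι', inferInstance, b.tensorProduct b', fun i => wt i.1 + wt' i.2, ?_⟩
    rintro ⟨i, j⟩ n
    simp only [Uq.comul, AlgHom.comp_apply, Uq.lift_K, Algebra.TensorProduct.map_tmul,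
      Module.endTensorEndAlgHom_apply, Module.Basis.tensorProduct_apply,
      TensorProduct.AlgebraTensorModule.map_tmul, hb, hb', ← TensorProduct.smul_tmul',
      TensorProduct.tmul_smul, smul_smul, ← zpow_add₀ s_ne_zero]
    congr 2
    ring

/-- The (left) dual representation; `(x f)(v) = f(S(x) v)`. -/
def dual (W : Rep) : Rep where
  V := Module.Dual K4 W.V
  ρ := AlgHom.ofLinearMap
    { toFun := fun x => (W.ρ (Uq.antipode x)).dualMap
      map_add' := fun x y => by ext; simp [Uq.antipode]
      map_smul' := fun c x => by ext; simp [Uq.antipode] }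
    (by ext; simp [Uq.antipode])
    (fun x y => by ext; simp [Uq.antipode])
  exists_weight_basis := by
    classical
    obtain ⟨ι, _, b, wt, hb⟩ := W.exists_weight_basis
    refine ⟨ι, inferInstance, b.dualBasis, fun i => -wt i, fun i n => b.ext fun j => ?_⟩
    simp only [Uq.antipode, Uq.antipodeOp, AlgHom.ofLinearMap_apply, LinearMap.coe_mk,
      AddHom.coe_mk, Uq.lift_K, MulOpposite.unop_op, LinearMap.dualMap_apply, hb, map_smul,
      LinearMap.smul_apply, Module.Basis.coe_dualBasis, Module.Basis.coord_apply,
      Module.Basis.repr_self, smul_eq_mul, Finsupp.single_apply]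
    split_ifs with h
    · subst h; congr 2; ring
    · simp

end Rep

/-! ### The irreducible representations -/

/-- The value of `f : Fin (n + 1) → K4` at `j`, extended by zero. -/
def ext0 {n : ℕ} (f : Fin (n + 1) → K4) (j : ℕ) : K4 := if h : j < n + 1 then f ⟨j, h⟩ else 0

/-- `E v_j = [n - j + 1] v_(j-1)` on the representation with highest weight `n`. -/
def irrepE (n : ℕ) : Module.End K4 (Fin (n + 1) → K4) where
  toFun f := fun i => qInt ((n : ℤ) - (i : ℕ)) * ext0 f (i + 1)
  map_add' f g := by
    ext i; simp only [ext0, Pi.add_apply]; split_ifs <;> ring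
  map_smul' c f := by
    ext i; simp only [ext0, Pi.smul_apply, smul_eq_mul, RingHom.id_apply]; split_ifs <;> ring

/-- `F v_j = [j + 1] v_(j+1)` on the representation with highest weight `n`. -/
def irrepF (n : ℕ) : Module.End K4 (Fin (n + 1) → K4) where
  toFun f := fun i => qInt (i : ℕ) * ext0 f (i - 1)
  map_add' f g := by
    ext i; simp only [ext0, Pi.add_apply]; split_ifs <;> ring
  map_smul' c f := by
    ext i; simp only [ext0, Pi.smul_apply, smul_eq_mul, RingHom.id_apply]; split_ifs <;> ring

/-- `K_w v_j = q^(r (n - 2 j) / 2) v_j` for `w = r · H/2`; the vector `v_j` has weight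
`n - 2 j`. -/
def irrepK (n : ℕ) (r : ℤ) : Module.End K4 (Fin (n + 1) → K4) where
  toFun f := fun i => s ^ (2 * r * ((n : ℤ) - 2 * (i : ℕ))) * f i
  map_add' f g := by ext i; simp only [Pi.add_apply]; ring
  map_smul' c f := by
    ext i; simp only [Pi.smul_apply, smul_eq_mul, RingHom.id_apply]; ring

lemma qInt_zero : qInt 0 = 0 := by simp [qInt]

lemma qInt_identity (n i : ℤ) :
    qInt (n - i) * qInt (i + 1) - qInt i * qInt (n - i + 1) =
      (q - q⁻¹)⁻¹ * (q ^ (n - 2 * i) - q ^ (-(n - 2 * i))) := by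
  by_cases h : q - q⁻¹ = 0
  · simp [qInt, h]
  have hq := q_ne_zero
  have hn : q ^ n ≠ 0 := zpow_ne_zero _ hq
  have hi : q ^ i ≠ 0 := zpow_ne_zero _ hq
  have e1 : q ^ (n - i) = q ^ n / q ^ i := by rw [zpow_sub₀ hq]
  have e2 : q ^ (n - i + 1) = q ^ n / q ^ i * q := by rw [zpow_add_one₀ hq, e1]
  have e3 : q ^ (i + 1) = q ^ i * q := by rw [zpow_add_one₀ hq]
  have e4 : q ^ (n - 2 * i) = q ^ n / (q ^ i * q ^ i) := by
    rw [zpow_sub₀ hq, two_mul, zpow_add₀ hq]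
  simp only [qInt, zpow_neg, e1, e2, e3, e4]
  generalize q ^ n = a at *
  generalize q ^ i = b at *
  generalize hd : q - q⁻¹ = d at *
  have key : (a / b - (a / b)⁻¹) * (b * q - (b * q)⁻¹) - (b - b⁻¹) * (a / b * q - (a / b * q)⁻¹)
      = d * (a / (b * b) - (a / (b * b))⁻¹) := by
    rw [← hd]; field_simp; ring
  rw [div_mul_div_comm, div_mul_div_comm, ← sub_div, key]
  field_simp

/-- The irreducible representation `V_λ` with highest weight `λ = n · ω`: it has the basis
`v_0, …, v_n` (the standard basis of `K4^(n+1)`), where `v_j` has weight `(n - 2 j) ω`,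
`E v_j = [n - j + 1] v_(j-1)` and `F v_j = [j + 1] v_(j+1)`. -/
def irrep (n : ℕ) : Rep where
  V := Fin (n + 1) → K4
  ρ := Uq.lift (irrepE n) (irrepF n) (irrepK n)
    (by ext f i; simp [irrepK])
    (fun a b => by
      ext f i
      simp only [irrepK, LinearMap.coe_comp, LinearMap.coe_mk, AddHom.coe_mk, Function.comp_apply,
        Module.End.mul_apply, ← mul_assoc, ← zpow_add₀ s_ne_zero]
      congr 2; ring)
    (fun a => by
      refine LinearMap.ext fun f => funext fun i => ?_
      simp only [irrepK, irrepE, ext0, LinearMap.coe_mk, AddHom.coe_mk, Module.End.mul_apply,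
        LinearMap.smul_apply, Pi.smul_apply, smul_eq_mul]
      split_ifs with h
      · have : s ^ (2 * a * ((n : ℤ) - 2 * (i : ℕ))) =
            q ^ a * s ^ (2 * a * ((n : ℤ) - 2 * ((i : ℕ) + 1 : ℕ))) := by
          rw [q, ← zpow_natCast s 4, ← zpow_mul, ← zpow_add₀ s_ne_zero]
          congr 1; push_cast; ring
        rw [this]; ring
      · simp)
    (fun a => by
      refine LinearMap.ext fun f => funext fun i => ?_
      simp only [irrepK, irrepF, ext0, LinearMap.coe_mk, AddHom.coe_mk, Module.End.mul_apply,
        LinearMap.smul_apply, Pi.smul_apply, smul_eq_mul]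
      rcases Nat.eq_zero_or_pos (i : ℕ) with h0 | h0
      · simp [h0, qInt_zero]
      split_ifs with h
      · have : s ^ (2 * a * ((n : ℤ) - 2 * (i : ℕ))) =
            q ^ (-a) * s ^ (2 * a * ((n : ℤ) - 2 * ((i : ℕ) - 1 : ℕ))) := by
          rw [q, ← zpow_natCast s 4, ← zpow_mul, ← zpow_add₀ s_ne_zero]
          congr 1; push_cast [h0]; ring
        rw [this]; ring
      · simp)
    (by
      refine LinearMap.ext fun f => funext fun i => ?_
      have hq4 : ∀ m : ℤ, s ^ (2 * 2 * m) = q ^ m := fun m => by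
        rw [q, ← zpow_natCast s 4, ← zpow_mul]; norm_num
      have hq4' : ∀ m : ℤ, s ^ (2 * (-2) * m) = q ^ (-m) := fun m => by
        rw [← hq4]; congr 1; ring
      have hi := i.isLt
      have key := qInt_identity n (i : ℕ)
      have hE : irrepE n (irrepF n f) i = qInt ((n : ℤ) - (i : ℕ)) * qInt ((i : ℕ) + 1) * f i := by
        simp only [irrepE, irrepF, ext0, LinearMap.coe_mk, AddHom.coe_mk]
        split_ifs with h h'
        · simp [mul_assoc]
        · exact absurd hi (by omega)
        · have : (n : ℤ) - (i : ℕ) = 0 := by omega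
          simp [this, qInt_zero]
      have hF : irrepF n (irrepE n f) i = qInt (i : ℕ) * qInt ((n : ℤ) - (i : ℕ) + 1) * f i := by
        rcases Nat.eq_zero_or_pos (i : ℕ) with h0 | h0
        · simp [irrepF, h0, qInt_zero]
        simp only [irrepE, irrepF, ext0, LinearMap.coe_mk, AddHom.coe_mk]
        have e : (i : ℕ) - 1 + 1 = (i : ℕ) := by omega
        have e' : (n : ℤ) - ((i : ℕ) - 1 : ℕ) = (n : ℤ) - (i : ℕ) + 1 := by omega
        rw [dif_pos (by omega)]
        simp only [e, e', hi, dif_pos, Fin.eta, mul_assoc]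
      simp only [LinearMap.sub_apply, Module.End.mul_apply, Pi.sub_apply, hE, hF,
        LinearMap.smul_apply, Pi.smul_apply, smul_eq_mul, irrepK, LinearMap.coe_mk, AddHom.coe_mk,
        hq4, hq4']
      linear_combination f i * key)
  exists_weight_basis := by
    refine ⟨Fin (n + 1), inferInstance, Pi.basisFun K4 _, fun i => (n : ℤ) - 2 * (i : ℕ), ?_⟩
    intro i r
    rw [Uq.lift_K]
    ext j
    by_cases h : j = i
    · subst h; simp [irrepK]
    · simp [irrepK, h]

/-- The standard representation of `U_q(sl₂)`: the two-dimensional `V_ω`, with basis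
`v_+ = v_0`, `v_- = v_1`, where `E v_- = v_+`, `F v_+ = v_-` and `K v_± = q^(±1) v_±`. -/
def standardRep : Rep := irrep 1

/-! ### The completion of `U_q(sl₂)` -/

/-- The completion of `U_q(sl₂)`: the product of the endomorphism rings of all irreducible
(finite-dimensional type 1) representations, with componentwise operations. -/
abbrev UHat : Type := ∀ n : ℕ, Module.End K4 (irrep n).V

namespace UHat

/-- The componentwise inverse (of an invertible element). -/
def inv (A : UHat) : UHat := fun n => Ring.inverse (A n)

/-- The action of an element of the completion on an arbitrary finite-dimensional type 1
representation `W`: the endomorphism of `W` that is compatible with all homomorphisms from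
irreducible representations to `W`. It exists and is unique because `W` is a direct sum of
irreducible representations. -/
def act (A : UHat) (W : Rep) : Module.End K4 W.V :=
  Classical.epsilon fun B : Module.End K4 W.V =>
    ∀ (n : ℕ) (φ : (irrep n).Hom W), B ∘ₗ φ.1 = φ.1 ∘ₗ A n

end UHat

/-- The completion of `U_q(sl₂) ⊗ U_q(sl₂)`: its elements are given by their actions on all
tensor products of two irreducible representations. -/
abbrev UHat2 : Type := ∀ m n : ℕ, Module.End K4 ((irrep m).V ⊗[K4] (irrep n).V)

namespace UHat2

/-- The action of an element of the completed tensor square on the tensor product of two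
arbitrary finite-dimensional type 1 representations, again determined by compatibility with
homomorphisms from irreducible representations in both factors. -/
def act (A : UHat2) (W W' : Rep) : Module.End K4 (W.V ⊗[K4] W'.V) :=
  Classical.epsilon fun B : Module.End K4 (W.V ⊗[K4] W'.V) =>
    ∀ (m n : ℕ) (φ : (irrep m).Hom W) (ψ : (irrep n).Hom W'),
      B ∘ₗ TensorProduct.map φ.1 ψ.1 = TensorProduct.map φ.1 ψ.1 ∘ₗ A m n

/-- The element `A ↦ A₂₁` with the two tensor factors exchanged. -/
def swap (A : UHat2) : UHat2 := fun m n =>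
  (TensorProduct.comm K4 (irrep n).V (irrep m).V).toLinearMap ∘ₗ A n m ∘ₗ
    (TensorProduct.comm K4 (irrep m).V (irrep n).V).toLinearMap

/-- An endomorphism of the tensor product of two finite-dimensional spaces, regarded as an element
of the tensor product of the two endomorphism algebras. -/
def toEndTensor (V W : Type) [AddCommGroup V] [Module K4 V] [Module.Finite K4 V]
    [AddCommGroup W] [Module K4 W] [Module.Finite K4 W] :
    Module.End K4 (V ⊗[K4] W) →ₗ[K4] Module.End K4 V ⊗[K4] Module.End K4 W :=
  (homTensorHomEquiv K4 V W V W).symm.toLinearMap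

/-- The transpose `End(V*) → End(V** ) = End(V)` for finite-dimensional `V`, characterized by
`f(βᵗ v) = (β f)(v)`. -/
def transposeBack (V : Type) [AddCommGroup V] [Module K4 V] [Module.Finite K4 V] :
    Module.End K4 (Module.Dual K4 V) →ₗ[K4] Module.End K4 V :=
  (Module.evalEquiv K4 V).symm.conj.toLinearMap ∘ₗ
    Module.Dual.transpose (R := K4) (M := Module.Dual K4 V) (M' := Module.Dual K4 V)

/-- The map `S ⊗ id`. By the definition of the dual representation, `S(x)` acts on `V` as the
transpose of the action of `x` on `V*`; so `S ⊗ id` takes the action on `V* ⊗ W` to the action on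
`V ⊗ W` by transposing the first factor. -/
def antipodeLeft (A : UHat2) : UHat2 := fun m n =>
  homTensorHomEquiv K4 (irrep m).V (irrep n).V (irrep m).V (irrep n).V
    (TensorProduct.map (transposeBack (irrep m).V) LinearMap.id
      (toEndTensor (irrep m).dual.V (irrep n).V (A.act (irrep m).dual (irrep n))))

/-- The multiplication map `μ(x ⊗ y) = x y`. -/
def mul (A : UHat2) : UHat := fun n =>
  LinearMap.mul' K4 (Module.End K4 (irrep n).V) (toEndTensor (irrep n).V (irrep n).V (A n n))

end UHat2

namespace UHat

/-- The coproduct of the completion: `Δ A` acts on `V ⊗ W` as `A` acts on the representation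
`V ⊗ W`. -/
def comul (A : UHat) : UHat2 := fun m n => A.act ((irrep m).tensor (irrep n))

/-- The element `A ⊗ B`. -/
def tmul (A B : UHat) : UHat2 := fun m n => TensorProduct.map (A m) (B n)

end UHat

/-! ### The half-ribbon element, the R-matrix and the ribbon elements -/

/-- The vector `v_i` of the irreducible representation with highest weight `n`. -/
def vec (n : ℕ) (i : Fin (n + 1)) : (irrep n).V := Pi.basisFun K4 (Fin (n + 1)) i

/-- The weight (as a multiple of `ω`) of the vector `v_i`. -/
def wt (n : ℕ) (i : Fin (n + 1)) : ℤ := (n : ℤ) - 2 * (i : ℕ)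

/-- The element of the completion whose value at the weight vector `v_i` of `V_n` is given, extended
linearly. -/
def ofVec (y : ∀ (n : ℕ), Fin (n + 1) → (irrep n).V) : UHat := fun n =>
  (Pi.basisFun K4 (Fin (n + 1))).constr K4 (y n)

/-- The braid group (quantum Weyl group) element `T = T_(w₀)`, Lusztig's `T''_(i,1)`:
on a vector `v` of weight `m`,
`T v = ∑ (-1)^b q^(b - a c) E^(a) F^(b) E^(c) v`, over all `a, b, c ≥ 0` with `-a + b - c = m`.
On `V_n` the powers `E^(n+1)` and `F^(n+1)` vanish, so that it is enough to sum over
`a, b, c ≤ n`. -/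
def T : UHat := ofVec fun n i =>
  ∑ a ∈ Finset.range (n + 1), ∑ b ∈ Finset.range (n + 1), ∑ c ∈ Finset.range (n + 1),
    if -(a : ℤ) + b - c = wt n i then
      ((-1 : K4) ^ b * q ^ ((b : ℤ) - a * c)) •
        (irrep n).ρ (Uq.Ediv a * Uq.Fdiv b * Uq.Ediv c) (vec n i)
    else 0

/-- The element `J`, acting on a vector of weight `μ` by `q^((μ, μ)/2 + (μ, ρ))`. For `μ = m ω`
this is `q^(m²/4 + m/2) = s^(m² + 2 m)`. -/
def J : UHat := ofVec fun n i => s ^ (wt n i ^ 2 + 2 * wt n i) • vec n i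

/-- The half-ribbon element `X = J T`. -/
def X : UHat := J * T

/-- The standard R-matrix `R = (X⁻¹ ⊗ X⁻¹) Δ(X)`. -/
def R : UHat2 := UHat.tmul X.inv X.inv * X.comul

/-- The Drinfeld element `u = μ ((S ⊗ id)(R₂₁))`. -/
def u : UHat := R.swap.antipodeLeft.mul

/-- The standard ribbon element `C`, acting on `V_λ` by the scalar `q^(-(λ, λ) - 2 (λ, ρ))`. For
`λ = n ω` this is `q^(-(n²/2 + n)) = s^(-(2 n² + 4 n))`. -/
def C : UHat := fun n => s ^ (-(2 * (n : ℤ) ^ 2 + 4 * n)) • (1 : Module.End K4 (irrep n).V)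

/-- The ribbon element `X⁻²`. -/
def XInvSq : UHat := X.inv ^ 2

/-! ### The pivotal structure and the Frobenius–Schur indicator -/

/-- The element `g = v⁻¹ u` attached to a ribbon element `v`. -/
def grouplike (v : UHat) : UHat := v.inv * u

/-- The pivotal structure `p_W : W → W**` attached to a ribbon element `v`: `p_W(x)(f) = f(g x)`. -/
def pivotal (v : UHat) (W : Rep) : W.V →ₗ[K4] W.dual.dual.V :=
  Module.Dual.eval K4 W.V ∘ₗ (grouplike v).act W

open Classical in
/-- The Frobenius–Schur indicator `FS_v(W)` of an absolutely simple representation `W` with respect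
to the ribbon element `v`. It is `0` if `W` is not isomorphic to `W*`; otherwise choose an
isomorphism `f : W → W*`, then `FS_v(W)` is the constant `c` with `f = c · f* ∘ p_W`. -/
def FS (v : UHat) (W : Rep) : K4 :=
  if h : Nonempty (W.Iso W.dual) then
    let f : W.V →ₗ[K4] W.dual.V := (Classical.choice h).1.toLinearMap
    Classical.epsilon fun c : K4 => f = c • (f.dualMap ∘ₗ pivotal v W)
  else 0

end QuantumSl2

end

open scoped TensorProduct

noncomputable section

namespace QuantumSl2

/-! ### Powers of the parameter -/

/-! On `V = V_ω` both indicators come down to one sign, read off from the action of `g = v⁻¹ u`. The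
representation is self-dual through the invariant form `B` with `B(v_+, v_-) = 1`, `B(v_-, v_+) =
-q⁻¹`, unique up to a scalar. The condition on the indicator `c` reads `B(x, y) = c · B(y, g x)`. If
`g = ε · diag(q, q⁻¹)` with `ε = ±1`, then `B(y, g x) = -ε · B(x, y)`, so `c = -ε`; this is
`FS_standard`.

It remains to find `ε`. By `u_one`, `u` acts on `V` by `s⁻⁶ · diag(q, q⁻¹)`. The element `C` acts by
`s⁻⁶`, while `X² = -s⁶` on `V`, so `X⁻²` acts by `-s⁻⁶`. Hence `ε = 1` for `C` and `ε = -1` for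
`X⁻²`.

To compute `u`, the element `X` is evaluated on `V_0`, `V_ω` and `V_(2 ω)`. The decomposition `V ⊗ V
= V_(2 ω) ⊕ V_0` then gives `Δ(X)` on `V ⊗ V` (`comul_X_one_one`) and thus the R-matrix
(`R_one_one`). The form turns `S` into the adjoint (`transposeBack_conj`), after which `μ (S ⊗ id)`
is a calculation with 2 × 2 matrices.

Actions of completed elements are specified only by compatibility with homomorphisms from
irreducibles. Each such action is therefore identified in two halves: a candidate compatible with
all these homomorphisms exists, and their images span. Since `q` is not a root of unity, a
homomorphism out of `V_n` is determined by the image of its highest weight vector, which must be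
killed by `E` and have weight `n`; on the spaces that occur this is solved in coordinates. -/

lemma s_pow_ne_one {m : ℕ} (hm : m ≠ 0) : s ^ m ≠ 1 := by
  intro h
  have h1 : (Polynomial.X : Polynomial ℂ) ^ m = 1 := by
    apply RatFunc.algebraMap_injective ℂ
    simpa [s] using h
  have h2 := congrArg Polynomial.natDegree h1
  simp at h2
  exact hm h2

lemma s_zpow_eq_one {m : ℤ} (h : s ^ m = 1) : m = 0 := by
  by_contra hm
  have hn : m.natAbs ≠ 0 := by omega
  apply s_pow_ne_one hn
  rcases Int.natAbs_eq m with e | e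
  · rwa [e, zpow_natCast] at h
  · rwa [e, zpow_neg, zpow_natCast, inv_eq_one] at h

/-- Distinct weights have distinct eigenvalues under `K_(H/2)`; this separates the irreducibles in
`hom_standard` and `hom_tensor`. -/
lemma s_zpow_injective {a b : ℤ} (h : s ^ a = s ^ b) : a = b := by
  have : s ^ (a - b) = 1 := by
    rw [zpow_sub₀ s_ne_zero, h, div_self (zpow_ne_zero _ s_ne_zero)]
  have := s_zpow_eq_one this
  omega

lemma q_zpow (m : ℤ) : q ^ m = s ^ (4 * m) := by
  rw [q, ← zpow_natCast s 4, ← zpow_mul]; rfl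

lemma q_zpow_sub_ne_zero {m : ℤ} (hm : m ≠ 0) : q ^ m - q ^ (-m) ≠ 0 := by
  rw [q_zpow, q_zpow, sub_ne_zero]
  intro h
  have := s_zpow_injective h
  omega

lemma q_sub_inv_ne_zero : q - q⁻¹ ≠ 0 := by
  simpa using q_zpow_sub_ne_zero one_ne_zero

lemma qInt_ne_zero {m : ℤ} (hm : m ≠ 0) : qInt m ≠ 0 :=
  div_ne_zero (q_zpow_sub_ne_zero hm) q_sub_inv_ne_zero

lemma qInt_one : qInt 1 = 1 := by
  simp [qInt, div_self q_sub_inv_ne_zero]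

lemma qInt_two : qInt 2 = q + q⁻¹ := by
  rw [qInt, div_eq_iff q_sub_inv_ne_zero]
  rw [zpow_neg]
  have := q_ne_zero
  norm_cast
  field_simp
  ring

/-! ### Homomorphisms of representations -/

lemma Uq.mem_adjoin_gens (x : Uq) : x ∈ Algebra.adjoin K4 (Set.range Uq.of) := by
  obtain ⟨y, rfl⟩ := RingQuot.mkAlgHom_surjective K4 Rel x
  change Uq.mk y ∈ _
  induction y using FreeAlgebra.induction with
  | grade0 r => rw [AlgHom.commutes]; exact Subalgebra.algebraMap_mem _ r
  | grade1 g => exact Algebra.subset_adjoin ⟨g, rfl⟩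
  | mul a b ha hb => rw [map_mul]; exact mul_mem ha hb
  | add a b ha hb => rw [map_add]; exact add_mem ha hb

/-- A linear map that commutes with the generators is a homomorphism of representations. -/
def Rep.Hom.ofGens {W W' : Rep} (φ : W.V →ₗ[K4] W'.V)
    (hE : ∀ x, φ (W.ρ Uq.E x) = W'.ρ Uq.E (φ x)) (hF : ∀ x, φ (W.ρ Uq.F x) = W'.ρ Uq.F (φ x))
    (hK : ∀ n x, φ (W.ρ (Uq.K n) x) = W'.ρ (Uq.K n) (φ x)) : W.Hom W' :=
  ⟨φ, fun x => by
    induction Uq.mem_adjoin_gens x using Algebra.adjoin_induction with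
    | mem x hx =>
      obtain ⟨g, rfl⟩ := hx
      ext v
      cases g with
      | E => exact hE v
      | F => exact hF v
      | K n => exact hK n v
    | algebraMap r => ext v; simp
    | add x y _ _ hx hy => rw [map_add, map_add, LinearMap.comp_add, hx, hy, LinearMap.add_comp]
    | mul x y _ _ hx hy =>
      rw [map_mul, map_mul, Module.End.mul_eq_comp, ← LinearMap.comp_assoc, hx,
        LinearMap.comp_assoc, hy, Module.End.mul_eq_comp, LinearMap.comp_assoc]⟩

lemma Rep.Hom.map_act {W W' : Rep} (φ : W.Hom W') (x : Uq) (v : W.V) :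
    φ.1 (W.ρ x v) = W'.ρ x (φ.1 v) := LinearMap.congr_fun (φ.2 x) v

lemma irrep_E (n : ℕ) : (irrep n).ρ Uq.E = irrepE n := by
  simp only [irrep]
  generalize_proofs
  erw [Uq.lift_E]

lemma irrep_F (n : ℕ) : (irrep n).ρ Uq.F = irrepF n := by
  simp only [irrep]
  generalize_proofs
  erw [Uq.lift_F]

lemma irrep_K (n : ℕ) (r : ℤ) : (irrep n).ρ (Uq.K r) = irrepK n r := by
  simp only [irrep]
  generalize_proofs
  erw [Uq.lift_K]

lemma irrepE_apply (n : ℕ) (f : Fin (n + 1) → K4) (i : Fin (n + 1)) :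
    irrepE n f i = qInt ((n : ℤ) - (i : ℕ)) * ext0 f (i + 1) := rfl

lemma irrepF_apply (n : ℕ) (f : Fin (n + 1) → K4) (i : Fin (n + 1)) :
    irrepF n f i = qInt (i : ℕ) * ext0 f (i - 1) := rfl

lemma irrepK_apply (n : ℕ) (r : ℤ) (f : Fin (n + 1) → K4) (i : Fin (n + 1)) :
    irrepK n r f i = s ^ (2 * r * ((n : ℤ) - 2 * (i : ℕ))) * f i := rfl

lemma vec_eq_single (n : ℕ) (i : Fin (n + 1)) :
    vec n i = (Pi.single i 1 : Fin (n + 1) → K4) := Pi.basisFun_apply ..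

lemma irrep_F_vec (n : ℕ) (j : ℕ) (h : j + 1 < n + 1) :
    (irrep n).ρ Uq.F (vec n ⟨j, by omega⟩) = qInt (j + 1) • vec n ⟨j + 1, h⟩ := by
  refine (LinearMap.congr_fun (irrep_F ..) _).trans ?_
  funext i
  rw [vec_eq_single, vec_eq_single]
  change irrepF n _ i = qInt (j + 1) * (Pi.single _ _ : Fin (n + 1) → K4) i
  have hi := i.isLt
  rw [irrepF_apply, ext0, dif_pos (by omega)]
  simp only [Pi.single_apply, Fin.ext_iff]
  -- At `i = 0` the index `i - 1` truncates to `0`, so the coordinate read there can be nonzero; the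
  -- factor `[0] = 0` removes it.
  by_cases h0 : (i : ℕ) = 0
  · simp [h0, qInt_zero]
  · by_cases h1 : (i : ℕ) = j + 1
    · simp [h1]
    · rw [if_neg (by omega), if_neg h1]; simp

lemma irrep_E_vec_zero (n : ℕ) : (irrep n).ρ Uq.E (vec n 0) = 0 := by
  refine (LinearMap.congr_fun (irrep_E ..) _).trans ?_
  funext i
  rw [vec_eq_single]
  change irrepE n _ i = (0 : K4)
  rw [irrepE_apply, ext0]
  split_ifs with h
  · rw [Pi.single_eq_of_ne (by rw [Ne, Fin.ext_iff]; exact Nat.succ_ne_zero _), mul_zero]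
  · rw [mul_zero]

lemma irrep_K_vec (n : ℕ) (r : ℤ) (i : Fin (n + 1)) :
    (irrep n).ρ (Uq.K r) (vec n i) = s ^ (2 * r * ((n : ℤ) - 2 * (i : ℕ))) • vec n i := by
  refine (LinearMap.congr_fun (irrep_K ..) _).trans ?_
  funext j
  rw [vec_eq_single]
  change irrepK n r _ j = _ * (Pi.single _ _ : Fin (n + 1) → K4) j
  rw [irrepK_apply]
  by_cases h : j = i
  · subst h; simp
  · simp [h]

lemma irrep_hom_ext {n : ℕ} {V : Type*} [AddCommGroup V] [Module K4 V]
    {φ ψ : (irrep n).V →ₗ[K4] V} (h : ∀ i, φ (vec n i) = ψ (vec n i)) : φ = ψ :=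
  (Pi.basisFun K4 (Fin (n + 1))).ext h

/-- A homomorphism out of an irreducible representation is determined by the image of the highest
weight vector. -/
lemma Rep.Hom.eq_smul {n : ℕ} {W : Rep} (φ ψ : (irrep n).Hom W) (c : K4)
    (h : φ.1 (vec n 0) = c • ψ.1 (vec n 0)) : φ.1 = c • ψ.1 := by
  refine irrep_hom_ext fun i => ?_
  obtain ⟨j, hj⟩ := i
  induction j with
  | zero => exact h
  | succ j ih =>
    -- Since `F v_j = [j + 1] v_(j+1)` with `[j + 1] ≠ 0`, the image of `v_j` determines that of
    -- `v_(j+1)`.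
    have h1 := φ.map_act Uq.F (vec n ⟨j, by omega⟩)
    have h2 := ψ.map_act Uq.F (vec n ⟨j, by omega⟩)
    rw [irrep_F_vec n j hj, map_smul] at h1 h2
    have hne : qInt ((j : ℤ) + 1) ≠ 0 := qInt_ne_zero (by omega)
    apply smul_right_injective _ hne
    simp only [LinearMap.smul_apply]
    rw [h1, ih (by omega), LinearMap.smul_apply, map_smul, ← h2, smul_comm]

/-- Together with `Rep.Hom.K_highest` this is the whole constraint used on the image of a highest
weight vector. In the targets below it leaves at most a line. -/
lemma Rep.Hom.E_highest {n : ℕ} {W : Rep} (φ : (irrep n).Hom W) :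
    W.ρ Uq.E (φ.1 (vec n 0)) = 0 := by
  rw [← φ.map_act, irrep_E_vec_zero, map_zero]

lemma Rep.Hom.K_highest {n : ℕ} {W : Rep} (φ : (irrep n).Hom W) :
    W.ρ (Uq.K 1) (φ.1 (vec n 0)) = s ^ (2 * (n : ℤ)) • φ.1 (vec n 0) := by
  rw [← φ.map_act, irrep_K_vec, map_smul]
  simp

lemma Rep.Hom.eq_zero {n : ℕ} {W : Rep} (φ : (irrep n).Hom W) (h : φ.1 (vec n 0) = 0) :
    φ.1 = 0 := by
  have := φ.eq_smul φ 0 (by simpa using h)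
  simpa using this

/-! ### Coordinates on the small irreducible representations -/

/-- The vector of `V_ω` with the given coordinates. -/
def vec1 (a b : K4) : (irrep 1).V := (![a, b] : Fin 2 → K4)

/-- The vector of `V_(2 ω)` with the given coordinates. -/
def vec2 (a b c : K4) : (irrep 2).V := (![a, b, c] : Fin 3 → K4)

lemma vec1_surj (x : (irrep 1).V) : ∃ a b, x = vec1 a b :=
  ⟨(x : Fin 2 → K4) 0, (x : Fin 2 → K4) 1, funext fun i => by fin_cases i <;> rfl⟩

lemma vec2_surj (x : (irrep 2).V) : ∃ a b c, x = vec2 a b c :=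
  ⟨(x : Fin 3 → K4) 0, (x : Fin 3 → K4) 1, (x : Fin 3 → K4) 2,
    funext fun i => by fin_cases i <;> rfl⟩

lemma vec_one_zero : vec 1 0 = vec1 1 0 := by
  funext i; simp only [vec, vec1, Pi.basisFun_apply]; fin_cases i <;> rfl

lemma vec_one_one : vec 1 1 = vec1 0 1 := by
  funext i; simp only [vec, vec1, Pi.basisFun_apply]; fin_cases i <;> rfl

lemma vec_two_zero : vec 2 0 = vec2 1 0 0 := by
  funext i; simp only [vec, vec2, Pi.basisFun_apply]; fin_cases i <;> rfl

lemma vec_two_one : vec 2 1 = vec2 0 1 0 := by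
  funext i; simp only [vec, vec2, Pi.basisFun_apply]; fin_cases i <;> rfl

lemma vec_two_two : vec 2 2 = vec2 0 0 1 := by
  funext i; simp only [vec, vec2, Pi.basisFun_apply]; fin_cases i <;> rfl

lemma vec1_inj {a b c d : K4} : vec1 a b = vec1 c d ↔ a = c ∧ b = d := by
  constructor
  · intro h
    exact ⟨congrFun h (0 : Fin 2), congrFun h (1 : Fin 2)⟩
  · rintro ⟨rfl, rfl⟩; rfl

lemma vec1_zero : vec1 0 0 = 0 := funext fun i => by fin_cases i <;> rfl

lemma vec1_smul (r a b : K4) : r • vec1 a b = vec1 (r * a) (r * b) :=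
  funext fun i => by fin_cases i <;> rfl

lemma vec1_neg (a b : K4) : -vec1 a b = vec1 (-a) (-b) :=
  funext fun i => by fin_cases i <;> rfl

lemma vec1_add (a b c d : K4) : vec1 a b + vec1 c d = vec1 (a + c) (b + d) :=
  funext fun i => by fin_cases i <;> rfl

lemma vec2_zero : vec2 0 0 0 = 0 := funext fun i => by fin_cases i <;> rfl

lemma vec2_smul (r a b c : K4) : r • vec2 a b c = vec2 (r * a) (r * b) (r * c) :=
  funext fun i => by fin_cases i <;> rfl

lemma vec2_neg (a b c : K4) : -vec2 a b c = vec2 (-a) (-b) (-c) :=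
  funext fun i => by fin_cases i <;> rfl

lemma vec2_add (a b c a' b' c' : K4) :
    vec2 a b c + vec2 a' b' c' = vec2 (a + a') (b + b') (c + c') :=
  funext fun i => by fin_cases i <;> rfl

lemma E_vec1 (a b : K4) : (irrep 1).ρ Uq.E (vec1 a b) = vec1 b 0 := by
  refine (LinearMap.congr_fun (irrep_E ..) _).trans (funext fun i => ?_)
  change irrepE 1 (![a, b] : Fin 2 → K4) i = (![b, 0] : Fin 2 → K4) i
  rw [irrepE_apply]
  fin_cases i <;> simp [ext0, qInt_one, qInt_zero]

lemma F_vec1 (a b : K4) : (irrep 1).ρ Uq.F (vec1 a b) = vec1 0 a := by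
  refine (LinearMap.congr_fun (irrep_F ..) _).trans (funext fun i => ?_)
  change irrepF 1 (![a, b] : Fin 2 → K4) i = (![0, a] : Fin 2 → K4) i
  rw [irrepF_apply]
  fin_cases i <;> simp [ext0, qInt_one, qInt_zero]

lemma K_vec1 (r : ℤ) (a b : K4) :
    (irrep 1).ρ (Uq.K r) (vec1 a b) = vec1 (s ^ (2 * r) * a) (s ^ (-(2 * r)) * b) := by
  refine (LinearMap.congr_fun (irrep_K ..) _).trans (funext fun i => ?_)
  change irrepK 1 r (![a, b] : Fin 2 → K4) i =
    (![s ^ (2 * r) * a, s ^ (-(2 * r)) * b] : Fin 2 → K4) i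
  rw [irrepK_apply]
  fin_cases i
  · simp
  · norm_num

lemma E_vec2 (a b c : K4) : (irrep 2).ρ Uq.E (vec2 a b c) = vec2 (qInt 2 * b) c 0 := by
  refine (LinearMap.congr_fun (irrep_E ..) _).trans (funext fun i => ?_)
  change irrepE 2 (![a, b, c] : Fin 3 → K4) i = (![qInt 2 * b, c, 0] : Fin 3 → K4) i
  rw [irrepE_apply]
  fin_cases i <;> simp [ext0, qInt_one, qInt_zero]

lemma F_vec2 (a b c : K4) : (irrep 2).ρ Uq.F (vec2 a b c) = vec2 0 a (qInt 2 * b) := by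
  refine (LinearMap.congr_fun (irrep_F ..) _).trans (funext fun i => ?_)
  change irrepF 2 (![a, b, c] : Fin 3 → K4) i = (![0, a, qInt 2 * b] : Fin 3 → K4) i
  rw [irrepF_apply]
  fin_cases i <;> simp [ext0, qInt_one, qInt_zero]

lemma K_vec2 (r : ℤ) (a b c : K4) :
    (irrep 2).ρ (Uq.K r) (vec2 a b c) = vec2 (s ^ (4 * r) * a) b (s ^ (-(4 * r)) * c) := by
  refine (LinearMap.congr_fun (irrep_K ..) _).trans (funext fun i => ?_)
  change irrepK 2 r (![a, b, c] : Fin 3 → K4) i =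
    (![s ^ (4 * r) * a, b, s ^ (-(4 * r)) * c] : Fin 3 → K4) i
  rw [irrepK_apply]
  fin_cases i
  · simp [show 2 * r * 2 = 4 * r by ring]
  · simp
  · norm_num [show 2 * r * -2 = -(4 * r) by ring]

/-! ### The half-ribbon element on the small irreducible representations -/

lemma Ediv_zero : Uq.Ediv 0 = 1 := by simp [Uq.Ediv, qFactorial]
lemma Ediv_one : Uq.Ediv 1 = Uq.E := by simp [Uq.Ediv, qFactorial, qInt_one]
lemma Ediv_two : Uq.Ediv 2 = (qInt 2)⁻¹ • (Uq.E * Uq.E) := by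
  simp [Uq.Ediv, qFactorial, qInt_one, Finset.prod_range_succ, sq, one_add_one_eq_two]
lemma Fdiv_zero : Uq.Fdiv 0 = 1 := by simp [Uq.Fdiv, qFactorial]
lemma Fdiv_one : Uq.Fdiv 1 = Uq.F := by simp [Uq.Fdiv, qFactorial, qInt_one]
lemma Fdiv_two : Uq.Fdiv 2 = (qInt 2)⁻¹ • (Uq.F * Uq.F) := by
  simp [Uq.Fdiv, qFactorial, qInt_one, Finset.prod_range_succ, sq, one_add_one_eq_two]

lemma ofVec_vec (y : ∀ n : ℕ, Fin (n + 1) → (irrep n).V) (n : ℕ) (i : Fin (n + 1)) :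
    ofVec y n (vec n i) = y n i :=
  (Pi.basisFun K4 (Fin (n + 1))).constr_basis K4 (y n) i

lemma J_vec (n : ℕ) (i : Fin (n + 1)) :
    J n (vec n i) = s ^ (wt n i ^ 2 + 2 * wt n i) • vec n i := ofVec_vec ..

lemma X_zero : X 0 = 1 := by
  refine irrep_hom_ext fun i => ?_
  obtain rfl : i = 0 := Fin.fin_one_eq_zero i
  change J 0 (T 0 (vec 0 0)) = vec 0 0
  have : T 0 (vec 0 0) = vec 0 0 := by
    rw [T, ofVec_vec]
    simp [wt, Ediv_zero, Fdiv_zero]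
  rw [this, J_vec]
  simp [wt]

lemma T_one_zero : T 1 (vec 1 0) = vec1 0 (-q) := by
  rw [T, ofVec_vec, vec_one_zero]
  simp [Finset.sum_range_succ, wt, Ediv_zero, Fdiv_zero, Ediv_one, Fdiv_one, E_vec1, F_vec1,
    vec1_smul, vec1_neg, vec1_zero]

/-- The triples `(a, b, c) = (1, 0, 0)`, `(0, 0, 1)` and `(1, 1, 1)` contribute `v_+`, `v_+` and
`-v_+`. -/
lemma T_one_one : T 1 (vec 1 1) = vec1 1 0 := by
  rw [T, ofVec_vec, vec_one_one]
  simp [Finset.sum_range_succ, wt, Ediv_zero, Fdiv_zero, Ediv_one, Fdiv_one, E_vec1, F_vec1,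
    vec1_neg, vec1_add, vec1_zero]

lemma T_two_zero : T 2 (vec 2 0) = vec2 0 0 (q ^ 2) := by
  have h2 : qInt 2 ≠ 0 := qInt_ne_zero two_ne_zero
  rw [T, ofVec_vec, vec_two_zero]
  simp [Finset.sum_range_succ, wt, Ediv_zero, Fdiv_zero, Ediv_one, Fdiv_one, Ediv_two, Fdiv_two,
    E_vec2, F_vec2, vec2_smul, vec2_zero, h2]

/-- The triples `(0, 0, 0)`, `(1, 1, 0)`, `(0, 1, 1)`, `(1, 2, 1)` contribute the coefficients `1`,
`-q[2]`, `-q[2]`, `q[2]`, with sum `1 - q[2] = -q²`. -/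
lemma T_two_one : T 2 (vec 2 1) = vec2 0 (-q ^ 2) 0 := by
  have h2 : qInt 2 ≠ 0 := qInt_ne_zero two_ne_zero
  rw [T, ofVec_vec, vec_two_one]
  simp [Finset.sum_range_succ, wt, Ediv_zero, Fdiv_zero, Ediv_one, Fdiv_one, Ediv_two, Fdiv_two,
    E_vec2, F_vec2, vec2_smul, vec2_neg, vec2_add, vec2_zero, h2]
  rw [qInt_two]
  have := q_ne_zero
  congr 1
  field_simp
  ring

lemma T_two_two : T 2 (vec 2 2) = vec2 1 0 0 := by
  have h2 : qInt 2 ≠ 0 := qInt_ne_zero two_ne_zero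
  rw [T, ofVec_vec, vec_two_two]
  simp [Finset.sum_range_succ, wt, Ediv_zero, Fdiv_zero, Ediv_one, Fdiv_one, Ediv_two, Fdiv_two,
    E_vec2, F_vec2, vec2_smul, vec2_neg, vec2_add, vec2_zero, h2]
  rw [qInt_two]
  have := q_ne_zero
  congr 1
  field_simp
  ring

lemma X_vec (n : ℕ) (i : Fin (n + 1)) : X n (vec n i) = J n (T n (vec n i)) := rfl

lemma J_one (a b : K4) : J 1 (vec1 a b) = vec1 (s ^ 3 * a) (s⁻¹ * b) := by
  have : vec1 a b = a • vec 1 0 + b • vec 1 1 := by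
    simp [vec_one_zero, vec_one_one, vec1_smul, vec1_add]
  rw [this, map_add, map_smul, map_smul, J_vec, J_vec, vec_one_zero, vec_one_one]
  simp only [vec1_smul, vec1_add, wt]
  norm_num [mul_comm]

lemma J_two (a b c : K4) : J 2 (vec2 a b c) = vec2 (s ^ 8 * a) b c := by
  have : vec2 a b c = a • vec 2 0 + b • vec 2 1 + c • vec 2 2 := by
    simp [vec_two_zero, vec_two_one, vec_two_two, vec2_smul, vec2_add]
  rw [this, map_add, map_add, map_smul, map_smul, map_smul, J_vec, J_vec, J_vec, vec_two_zero,
    vec_two_one, vec_two_two]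
  simp only [vec2_smul, vec2_add, wt]
  norm_num [mul_comm]

/-- On `v_+` the factor `-q = -s⁴` of `T` meets the factor `s⁻¹` of `J`; on `v_-` the factor `1`
meets `s³`. The two off-diagonal entries have opposite signs, so `X² = -s⁶`: this is the sign that
distinguishes `X⁻²` from `C` on `V_ω`. -/
lemma X_one (a b : K4) : X 1 (vec1 a b) = vec1 (s ^ 3 * b) (-s ^ 3 * a) := by
  have : vec1 a b = a • vec 1 0 + b • vec 1 1 := by
    simp [vec_one_zero, vec_one_one, vec1_smul, vec1_add]
  have hs := s_ne_zero
  rw [this, map_add, map_smul, map_smul, X_vec, X_vec, T_one_zero, T_one_one, J_one, J_one]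
  simp only [vec1_smul, vec1_add, q]
  congr 1
  · ring
  · field_simp
    ring

lemma X_two (a b c : K4) : X 2 (vec2 a b c) = vec2 (q ^ 2 * c) (-q ^ 2 * b) (q ^ 2 * a) := by
  have : vec2 a b c = a • vec 2 0 + b • vec 2 1 + c • vec 2 2 := by
    simp [vec_two_zero, vec_two_one, vec_two_two, vec2_smul, vec2_add]
  rw [this, map_add, map_add, map_smul, map_smul, map_smul, X_vec, X_vec, X_vec, T_two_zero,
    T_two_one, T_two_two, J_two, J_two, J_two]
  simp only [vec2_smul, vec2_add, q]
  congr 1 <;> ring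

/-! ### Endomorphisms of the standard representation -/

/-- The first coordinate on `V_ω`. -/
def coord0 : (irrep 1).V →ₗ[K4] K4 := (LinearMap.proj 0 : (Fin 2 → K4) →ₗ[K4] K4)

/-- The second coordinate on `V_ω`. -/
def coord1 : (irrep 1).V →ₗ[K4] K4 := (LinearMap.proj 1 : (Fin 2 → K4) →ₗ[K4] K4)

lemma coord0_vec1 (a b : K4) : coord0 (vec1 a b) = a := rfl

lemma coord1_vec1 (a b : K4) : coord1 (vec1 a b) = b := rfl

/-- The endomorphism of `V_ω` with the given matrix. -/
def mat1 (a b c d : K4) : Module.End K4 (irrep 1).V :=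
  (a • coord0 + b • coord1).smulRight (vec1 1 0) + (c • coord0 + d • coord1).smulRight (vec1 0 1)

lemma mat1_vec1 (a b c d x y : K4) :
    mat1 a b c d (vec1 x y) = vec1 (a * x + b * y) (c * x + d * y) := by
  simp [mat1, coord0_vec1, coord1_vec1, vec1_smul, vec1_add]

lemma vec1_hom_ext {V : Type*} [AddCommGroup V] [Module K4 V] {f g : (irrep 1).V →ₗ[K4] V}
    (h : ∀ a b, f (vec1 a b) = g (vec1 a b)) : f = g := by
  ext x
  obtain ⟨a, b, rfl⟩ := vec1_surj x
  exact h a b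

lemma mat1_mul (a b c d a' b' c' d' : K4) :
    mat1 a b c d * mat1 a' b' c' d' =
      mat1 (a * a' + b * c') (a * b' + b * d') (c * a' + d * c') (c * b' + d * d') := by
  refine vec1_hom_ext fun x y => ?_
  simp only [Module.End.mul_apply, mat1_vec1]
  congr 1 <;> ring

lemma mat1_add (a b c d a' b' c' d' : K4) :
    mat1 a b c d + mat1 a' b' c' d' = mat1 (a + a') (b + b') (c + c') (d + d') := by
  refine vec1_hom_ext fun x y => ?_
  simp only [LinearMap.add_apply, mat1_vec1, vec1_add]
  congr 1 <;> ring

lemma mat1_smul (r a b c d : K4) :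
    r • mat1 a b c d = mat1 (r * a) (r * b) (r * c) (r * d) := by
  refine vec1_hom_ext fun x y => ?_
  simp only [LinearMap.smul_apply, mat1_vec1, vec1_smul]
  congr 1 <;> ring

lemma mat1_one : mat1 1 0 0 1 = 1 := by
  refine vec1_hom_ext fun x y => ?_
  simp [mat1_vec1]

lemma X_one_eq : X 1 = mat1 0 (s ^ 3) (-s ^ 3) 0 := by
  refine vec1_hom_ext fun x y => ?_
  simp [mat1_vec1, X_one]

/-- `UHat.inv` uses `Ring.inverse`, which is zero off the units, so a two-sided inverse has to be
exhibited. -/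
lemma inverse_mat1 {a b c d a' b' c' d' : K4} (h : mat1 a b c d * mat1 a' b' c' d' = 1)
    (h' : mat1 a' b' c' d' * mat1 a b c d = 1) :
    Ring.inverse (mat1 a b c d) = mat1 a' b' c' d' :=
  Ring.inverse_unit (⟨_, _, h, h'⟩ : (Module.End K4 (irrep 1).V)ˣ)

lemma X_inv_one : X.inv 1 = mat1 0 (-(s ^ 3)⁻¹) (s ^ 3)⁻¹ 0 := by
  have := pow_ne_zero 3 s_ne_zero
  rw [UHat.inv, X_one_eq]
  apply inverse_mat1 <;> rw [mat1_mul, ← mat1_one] <;> congr 1 <;> simp [this]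

/-! ### Homomorphisms to the standard representation -/

/-- The kernel of `E` on `V_ω` is the line of `v_+`, which has weight `1`. A highest weight vector
of another weight can only go to zero. -/
lemma hom_standard {m : ℕ} (φ : (irrep m).Hom (irrep 1)) :
    (m ≠ 1 → φ.1 = 0) ∧ ∃ a, φ.1 (vec m 0) = vec1 a 0 := by
  have hE := φ.E_highest
  have hK := φ.K_highest
  obtain ⟨a, b, hab⟩ := vec1_surj (φ.1 (vec m 0))
  rw [hab, E_vec1, ← vec1_zero, vec1_inj] at hE
  obtain rfl : b = 0 := hE.1
  refine ⟨fun hm => φ.eq_zero ?_, a, hab⟩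
  rw [hab, K_vec1, vec1_smul, vec1_inj] at hK
  have : a = 0 := by
    by_contra ha
    have := s_zpow_injective (mul_right_cancel₀ ha hK.1)
    omega
  rw [hab, this, vec1_zero]

/-- The identity homomorphism. -/
def Rep.Hom.id (W : Rep) : W.Hom W := ⟨LinearMap.id, fun _ => rfl⟩

lemma hom_standard_one (φ : (irrep 1).Hom (irrep 1)) : ∃ a : K4, φ.1 = a • LinearMap.id := by
  obtain ⟨-, a, ha⟩ := hom_standard φ
  refine ⟨a, φ.eq_smul (Rep.Hom.id _) a ?_⟩
  rw [ha, vec_one_zero]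
  simp [Rep.Hom.id, vec1_smul]

/-! ### The action on arbitrary representations -/

/-- The existence half: one compatible `B` suffices for `A.act W` to be compatible. Equality with
`B` requires in addition that the images of the homomorphisms `φ` span `W`. -/
lemma UHat.act_spec {A : UHat} {W : Rep} (B : Module.End K4 W.V)
    (hB : ∀ (n : ℕ) (φ : (irrep n).Hom W), B ∘ₗ φ.1 = φ.1 ∘ₗ A n) (n : ℕ)
    (φ : (irrep n).Hom W) : A.act W ∘ₗ φ.1 = φ.1 ∘ₗ A n :=
  Classical.epsilon_spec (p := fun B : Module.End K4 W.V =>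
    ∀ (n : ℕ) (φ : (irrep n).Hom W), B ∘ₗ φ.1 = φ.1 ∘ₗ A n) ⟨B, hB⟩ n φ

lemma UHat2.act_spec {A : UHat2} {W W' : Rep} (B : Module.End K4 (W.V ⊗[K4] W'.V))
    (hB : ∀ (m n : ℕ) (φ : (irrep m).Hom W) (ψ : (irrep n).Hom W'),
      B ∘ₗ TensorProduct.map φ.1 ψ.1 = TensorProduct.map φ.1 ψ.1 ∘ₗ A m n) (m n : ℕ)
    (φ : (irrep m).Hom W) (ψ : (irrep n).Hom W') :
    A.act W W' ∘ₗ TensorProduct.map φ.1 ψ.1 = TensorProduct.map φ.1 ψ.1 ∘ₗ A m n :=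
  Classical.epsilon_spec (p := fun B : Module.End K4 (W.V ⊗[K4] W'.V) =>
    ∀ (m n : ℕ) (φ : (irrep m).Hom W) (ψ : (irrep n).Hom W'),
      B ∘ₗ TensorProduct.map φ.1 ψ.1 = TensorProduct.map φ.1 ψ.1 ∘ₗ A m n) ⟨B, hB⟩ m n φ ψ

lemma UHat.act_standard (A : UHat) : A.act (irrep 1) = A 1 := by
  refine UHat.act_spec (A 1) (fun n φ => ?_) 1 (Rep.Hom.id _)
  by_cases hn : n = 1
  · subst hn
    obtain ⟨a, ha⟩ := hom_standard_one φ
    rw [ha, LinearMap.comp_smul, LinearMap.smul_comp, LinearMap.comp_id, LinearMap.id_comp]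
  · rw [(hom_standard φ).1 hn, LinearMap.comp_zero, LinearMap.zero_comp]

/-! ### The tensor square of the standard representation -/

/-- The vector of `V_ω ⊗ V_ω` with the given coordinates. -/
def tvec (a b c d : K4) : ((irrep 1).tensor (irrep 1)).V :=
  (vec1 1 0 ⊗ₜ[K4] vec1 a b + vec1 0 1 ⊗ₜ[K4] vec1 c d : (irrep 1).V ⊗[K4] (irrep 1).V)

/-- This fixes the order of the coordinates: `v_+ ⊗ v_+`, `v_+ ⊗ v_-`, `v_- ⊗ v_+`, `v_- ⊗ v_-`. -/
lemma vec1_tmul_vec1 (a b c d : K4) :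
    vec1 a b ⊗ₜ[K4] vec1 c d = tvec (a * c) (a * d) (b * c) (b * d) := by
  have : vec1 a b = a • vec1 1 0 + b • vec1 0 1 := by simp [vec1_smul, vec1_add]
  rw [this, TensorProduct.add_tmul, TensorProduct.smul_tmul, TensorProduct.smul_tmul, vec1_smul,
    vec1_smul]
  rfl

lemma tvec_add (a b c d a' b' c' d' : K4) :
    tvec a b c d + tvec a' b' c' d' = tvec (a + a') (b + b') (c + c') (d + d') := by
  rw [tvec, tvec, tvec, ← vec1_add, ← vec1_add, TensorProduct.tmul_add, TensorProduct.tmul_add]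
  exact add_add_add_comm ..

lemma tvec_smul (r a b c d : K4) :
    r • tvec a b c d = tvec (r * a) (r * b) (r * c) (r * d) := by
  rw [tvec, tvec, ← vec1_smul, ← vec1_smul, TensorProduct.tmul_smul, TensorProduct.tmul_smul]
  exact smul_add ..

lemma tvec_surj (x : ((irrep 1).tensor (irrep 1)).V) : ∃ a b c d, x = tvec a b c d := by
  change (irrep 1).V ⊗[K4] (irrep 1).V at x
  induction x with
  | zero =>
    refine ⟨0, 0, 0, 0, ?_⟩
    rw [tvec, vec1_zero, TensorProduct.tmul_zero, TensorProduct.tmul_zero, add_zero]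
  | tmul x y =>
    obtain ⟨a, b, rfl⟩ := vec1_surj x
    obtain ⟨c, d, rfl⟩ := vec1_surj y
    exact ⟨_, _, _, _, vec1_tmul_vec1 ..⟩
  | add x y hx hy =>
    obtain ⟨a, b, c, d, rfl⟩ := hx
    obtain ⟨a', b', c', d', rfl⟩ := hy
    exact ⟨_, _, _, _, tvec_add ..⟩

lemma tvec_inj {a b c d a' b' c' d' : K4} :
    tvec a b c d = tvec a' b' c' d' ↔ a = a' ∧ b = b' ∧ c = c' ∧ d = d' := by
  constructor
  · intro h
    -- Applying `f ⊗ g` for the four pairs of coordinate functionals isolates the four coefficients.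
    have key : ∀ f g : (irrep 1).V →ₗ[K4] K4,
        f (vec1 1 0) * g (vec1 a b) + f (vec1 0 1) * g (vec1 c d) =
          f (vec1 1 0) * g (vec1 a' b') + f (vec1 0 1) * g (vec1 c' d') := fun f g => by
      have := congrArg (LinearMap.mul' K4 K4 ∘ₗ TensorProduct.map f g) h
      simpa [tvec] using this
    exact ⟨by simpa [coord0_vec1] using key coord0 coord0,
      by simpa [coord0_vec1, coord1_vec1] using key coord0 coord1,
      by simpa [coord0_vec1, coord1_vec1] using key coord1 coord0,
      by simpa [coord1_vec1] using key coord1 coord1⟩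
  · rintro ⟨rfl, rfl, rfl, rfl⟩; rfl

lemma tvec_zero : tvec 0 0 0 0 = 0 := by
  have := tvec_smul 0 0 0 0 0
  rwa [zero_smul, zero_mul, eq_comm] at this

lemma tensor_act (W W' : Rep) (x : Uq) (t : W.V ⊗[K4] W'.V) :
    (W.tensor W').ρ x t =
      Module.endTensorEndAlgHom (R := K4) (S := K4) (A := K4) (M := W.V) (N := W'.V)
      (Algebra.TensorProduct.map W.ρ W'.ρ (Uq.comul x)) t := rfl

lemma tensor_E (W W' : Rep) (x : W.V) (y : W'.V) :
    (W.tensor W').ρ Uq.E (x ⊗ₜ[K4] y) =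
      W.ρ Uq.E x ⊗ₜ[K4] W'.ρ (Uq.K 2) y + x ⊗ₜ[K4] W'.ρ Uq.E y := by
  rw [tensor_act, Uq.comul, Uq.lift_E]
  simp only [map_add, map_one, LinearMap.add_apply, Algebra.TensorProduct.map_tmul]
  rfl

lemma tensor_F (W W' : Rep) (x : W.V) (y : W'.V) :
    (W.tensor W').ρ Uq.F (x ⊗ₜ[K4] y) =
      W.ρ Uq.F x ⊗ₜ[K4] y + W.ρ (Uq.K (-2)) x ⊗ₜ[K4] W'.ρ Uq.F y := by
  rw [tensor_act, Uq.comul, Uq.lift_F]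
  simp only [map_add, map_one, LinearMap.add_apply, Algebra.TensorProduct.map_tmul]
  rfl

lemma tensor_K (W W' : Rep) (n : ℤ) (x : W.V) (y : W'.V) :
    (W.tensor W').ρ (Uq.K n) (x ⊗ₜ[K4] y) = W.ρ (Uq.K n) x ⊗ₜ[K4] W'.ρ (Uq.K n) y := by
  rw [tensor_act, Uq.comul, Uq.lift_K]
  simp only [Algebra.TensorProduct.map_tmul]
  rfl

lemma map_tvec {V : Type*} [AddCommGroup V] [Module K4 V]
    (f : ((irrep 1).tensor (irrep 1)).V →ₗ[K4] V) (a b c d : K4) :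
    f (tvec a b c d) = f (vec1 1 0 ⊗ₜ[K4] vec1 a b) + f (vec1 0 1 ⊗ₜ[K4] vec1 c d) :=
  map_add f _ _

lemma E_vec1_tmul (a b c d : K4) :
    ((irrep 1).tensor (irrep 1)).ρ Uq.E (vec1 a b ⊗ₜ[K4] vec1 c d) =
      tvec (b * (q * c) + a * d) (b * (q⁻¹ * d)) (b * d) 0 := by
  rw [tensor_E, E_vec1, E_vec1, K_vec1, vec1_tmul_vec1, vec1_tmul_vec1]
  refine (tvec_add ..).trans ?_
  have h : s ^ (4 : ℤ) = q := by norm_cast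
  rw [show (2 : ℤ) * 2 = 4 by norm_num, zpow_neg, h]
  congr 1 <;> ring

lemma F_vec1_tmul (a b c d : K4) :
    ((irrep 1).tensor (irrep 1)).ρ Uq.F (vec1 a b ⊗ₜ[K4] vec1 c d) =
      tvec 0 (q⁻¹ * a * c) (a * c) (a * d + q * b * c) := by
  rw [tensor_F, F_vec1, F_vec1, K_vec1, vec1_tmul_vec1, vec1_tmul_vec1]
  refine (tvec_add ..).trans ?_
  have h : s ^ (4 : ℤ) = q := by norm_cast
  rw [show (2 : ℤ) * -2 = -4 by norm_num, neg_neg, zpow_neg, h]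
  congr 1 <;> ring

lemma E_tvec (a b c d : K4) :
    ((irrep 1).tensor (irrep 1)).ρ Uq.E (tvec a b c d) = tvec (b + q * c) (q⁻¹ * d) d 0 := by
  rw [map_tvec, E_vec1_tmul, E_vec1_tmul, tvec_add]
  congr 1 <;> ring

lemma F_tvec (a b c d : K4) :
    ((irrep 1).tensor (irrep 1)).ρ Uq.F (tvec a b c d) = tvec 0 (q⁻¹ * a) a (b + q * c) := by
  rw [map_tvec, F_vec1_tmul, F_vec1_tmul, tvec_add]
  congr 1 <;> ring

lemma K_vec1_tmul (r : ℤ) (a b c d : K4) :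
    ((irrep 1).tensor (irrep 1)).ρ (Uq.K r) (vec1 a b ⊗ₜ[K4] vec1 c d) =
      tvec (s ^ (4 * r) * (a * c)) (a * d) (b * c) (s ^ (-(4 * r)) * (b * d)) := by
  have hs := zpow_ne_zero r s_ne_zero
  have h2 : s ^ (2 * r) = s ^ r * s ^ r := by rw [two_mul, zpow_add₀ s_ne_zero]
  have h4 : s ^ (4 * r) = s ^ (2 * r) * s ^ (2 * r) := by
    rw [← zpow_add₀ s_ne_zero]; congr 1; ring
  rw [tensor_K, K_vec1, K_vec1, vec1_tmul_vec1, zpow_neg, zpow_neg, h4, h2]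
  congr 1 <;> field_simp

lemma K_tvec (r : ℤ) (a b c d : K4) :
    ((irrep 1).tensor (irrep 1)).ρ (Uq.K r) (tvec a b c d) =
      tvec (s ^ (4 * r) * a) b c (s ^ (-(4 * r)) * d) := by
  rw [map_tvec, K_vec1_tmul, K_vec1_tmul, tvec_add]
  congr 1 <;> ring

/-- This is `q[2]`, the denominator in the splitting of `V_ω ⊗ V_ω` into its two summands. -/
lemma q_sq_add_one_ne_zero : q ^ 2 + 1 ≠ 0 := by
  have h := qInt_ne_zero two_ne_zero
  have hq := q_ne_zero
  rw [qInt_two] at h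
  contrapose! h
  field_simp
  linear_combination h

/-- The linear map underlying the embedding of `V_(2 ω)` into the tensor square of `V_ω`. -/
def symMap : (irrep 2).V →ₗ[K4] ((irrep 1).tensor (irrep 1)).V :=
  -- The images are `v_+ ⊗ v_+`, its image under `F`, and its image under `F^(2)`.
  (Pi.basisFun K4 (Fin 3)).constr K4 ![tvec 1 0 0 0, tvec 0 q⁻¹ 1 0, tvec 0 0 0 1]

lemma symMap_vec2 (a b c : K4) : symMap (vec2 a b c) = tvec a (q⁻¹ * b) b c := by
  refine ((Pi.basisFun K4 (Fin 3)).constr_apply_fintype K4 _ _).trans ?_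
  rw [Fin.sum_univ_three]
  simp [vec2, tvec_smul, tvec_add, mul_comm b]

/-- The embedding of `V_(2 ω)` into the tensor square of `V_ω`. -/
def symHom : (irrep 2).Hom ((irrep 1).tensor (irrep 1)) :=
  Rep.Hom.ofGens symMap
    (fun x => by
      obtain ⟨a, b, c, rfl⟩ := vec2_surj x
      rw [E_vec2, symMap_vec2, symMap_vec2, E_tvec, qInt_two, tvec_inj]
      refine ⟨by ring, rfl, rfl, rfl⟩)
    (fun x => by
      obtain ⟨a, b, c, rfl⟩ := vec2_surj x
      rw [F_vec2, symMap_vec2, symMap_vec2, F_tvec, qInt_two, tvec_inj]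
      refine ⟨rfl, rfl, rfl, by ring⟩)
    (fun r x => by
      obtain ⟨a, b, c, rfl⟩ := vec2_surj x
      rw [K_vec2, symMap_vec2, symMap_vec2, K_tvec])

lemma symHom_vec2 (a b c : K4) : symHom.1 (vec2 a b c) = tvec a (q⁻¹ * b) b c := symMap_vec2 ..

lemma vec_zero_surj (x : (irrep 0).V) : ∃ a : K4, x = a • vec 0 0 := by
  refine ⟨(x : Fin 1 → K4) 0, funext fun i => ?_⟩
  rw [vec_eq_single]
  fin_cases i
  exact (mul_one _).symm

/-- The linear map underlying the embedding of the trivial representation into the tensor square of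
`V_ω`. -/
def trivMap : (irrep 0).V →ₗ[K4] ((irrep 1).tensor (irrep 1)).V :=
  -- The vector `tvec 0 (-q) 1 0` spans the weight-zero part of the kernel of `E`.
  (LinearMap.proj 0 : (Fin 1 → K4) →ₗ[K4] K4).smulRight (tvec 0 (-q) 1 0)

lemma trivMap_vec : trivMap (vec 0 0) = tvec 0 (-q) 1 0 := by
  rw [vec_eq_single]
  exact one_smul K4 _

lemma irrep_F_vec_last (n : ℕ) : (irrep n).ρ Uq.F (vec n (Fin.last n)) = 0 := by
  refine (LinearMap.congr_fun (irrep_F ..) _).trans ?_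
  funext i
  rw [vec_eq_single]
  change irrepF n _ i = (0 : K4)
  rw [irrepF_apply, ext0]
  split_ifs with h
  · by_cases h0 : (i : ℕ) = 0
    · rw [show qInt ((i : ℕ) : ℤ) = 0 by rw [h0, Nat.cast_zero, qInt_zero], zero_mul]
    · rw [Pi.single_eq_of_ne, mul_zero]
      rw [Ne, Fin.ext_iff, Fin.val_last]
      have := i.isLt
      dsimp only
      omega
  · rw [mul_zero]

/-- The embedding of the trivial representation into the tensor square of `V_ω`. -/
def trivHom : (irrep 0).Hom ((irrep 1).tensor (irrep 1)) :=
  Rep.Hom.ofGens trivMap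
    (fun x => by
      obtain ⟨a, rfl⟩ := vec_zero_surj x
      rw [map_smul, irrep_E_vec_zero, smul_zero, map_zero, map_smul, map_smul, trivMap_vec, E_tvec,
        ← smul_zero a, ← tvec_zero]
      congr 2 <;> simp)
    (fun x => by
      obtain ⟨a, rfl⟩ := vec_zero_surj x
      rw [map_smul, show (irrep 0).ρ Uq.F (vec 0 0) = 0 from irrep_F_vec_last 0, smul_zero,
        map_zero, map_smul, map_smul, trivMap_vec, F_tvec, ← smul_zero a, ← tvec_zero]
      congr 2 <;> simp)
    (fun r x => by
      obtain ⟨a, rfl⟩ := vec_zero_surj x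
      rw [map_smul, map_smul, map_smul, map_smul, irrep_K_vec, map_smul, trivMap_vec, K_tvec]
      simp)

lemma trivHom_vec : trivHom.1 (vec 0 0) = tvec 0 (-q) 1 0 := trivMap_vec

/-- The kernel of `E` on `V_ω ⊗ V_ω` is cut out by `b + q c = 0` and `d = 0`. The coordinate `a` has
weight `2`, while `b` and `c` have weight `0`, so only `m = 2` and `m = 0` can occur. -/
lemma hom_tensor (m : ℕ) (φ : (irrep m).Hom ((irrep 1).tensor (irrep 1))) :
    ∃ a b c : K4, φ.1 (vec m 0) = tvec a b c 0 ∧ b + q * c = 0 ∧ (m ≠ 2 → a = 0) ∧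
      (m ≠ 0 → b = 0 ∧ c = 0) := by
  have hE := φ.E_highest
  have hK := φ.K_highest
  obtain ⟨a, b, c, d, h⟩ := tvec_surj (φ.1 (vec m 0))
  rw [h, E_tvec, ← tvec_zero, tvec_inj] at hE
  rw [h, K_tvec, tvec_smul, tvec_inj] at hK
  obtain ⟨h1, -, rfl, -⟩ := hE
  obtain ⟨k1, k2, k3, -⟩ := hK
  have key : ∀ x : K4, x = s ^ (2 * (m : ℤ)) * x → m ≠ 0 → x = 0 := fun x hx hm => by
    by_contra h0
    have := s_zpow_eq_one (mul_right_cancel₀ h0 ((one_mul x).trans hx)).symm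
    omega
  refine ⟨a, b, c, h, h1, fun hm => ?_, fun hm => ⟨key b k2 hm, key c k3 hm⟩⟩
  by_contra h0
  have := s_zpow_injective (mul_right_cancel₀ h0 k1)
  omega

lemma hom_tensor_two (φ : (irrep 2).Hom ((irrep 1).tensor (irrep 1))) :
    ∃ a : K4, φ.1 = a • symHom.1 := by
  obtain ⟨a, b, c, h, -, -, h2⟩ := hom_tensor 2 φ
  obtain ⟨rfl, rfl⟩ := h2 two_ne_zero
  refine ⟨a, φ.eq_smul _ a ?_⟩
  rw [h, vec_two_zero, symHom_vec2, tvec_smul]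
  simp

lemma hom_tensor_zero (φ : (irrep 0).Hom ((irrep 1).tensor (irrep 1))) :
    ∃ a : K4, φ.1 = a • trivHom.1 := by
  obtain ⟨a, b, c, h, h1, h2, -⟩ := hom_tensor 0 φ
  obtain rfl := h2 (by norm_num)
  refine ⟨c, φ.eq_smul _ c ?_⟩
  rw [h, trivHom_vec, tvec_smul, tvec_inj]
  exact ⟨by ring, by linear_combination h1, by ring, by ring⟩

lemma hom_tensor_of_ne {m : ℕ} (h0 : m ≠ 0) (h2 : m ≠ 2)
    (φ : (irrep m).Hom ((irrep 1).tensor (irrep 1))) : φ.1 = 0 := by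
  obtain ⟨a, b, c, h, -, ha, hbc⟩ := hom_tensor m φ
  obtain ⟨rfl, rfl⟩ := hbc h0
  obtain rfl := ha h2
  exact φ.eq_zero (h.trans tvec_zero)

/-- The uniqueness half for the tensor square: the images of `symHom` and `trivHom` span it. -/
lemma hom_ext_of_summands {V : Type*} [AddCommGroup V] [Module K4 V]
    {f g : ((irrep 1).tensor (irrep 1)).V →ₗ[K4] V}
    (h2 : f ∘ₗ symHom.1 = g ∘ₗ symHom.1) (h0 : f ∘ₗ trivHom.1 = g ∘ₗ trivHom.1) : f = g := by
  ext x
  obtain ⟨a, b, c, d, rfl⟩ := tvec_surj x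
  have hq := q_sq_add_one_ne_zero
  -- The two coefficients `y`, `t` solve `q⁻¹ y - q t = b`, `y + t = c`, a system with determinant
  -- `q⁻¹ + q`.
  have key : tvec a b c d = symHom.1 (vec2 a (q * (b + q * c) / (q ^ 2 + 1)) d) +
      trivHom.1 (((c - q * b) / (q ^ 2 + 1)) • vec 0 0) := by
    rw [map_smul, symHom_vec2, trivHom_vec, tvec_smul, tvec_add, tvec_inj]
    have := q_ne_zero
    refine ⟨by ring, ?_, ?_, by ring⟩
    · field_simp; ring
    · field_simp; ring
  rw [key, map_add, map_add]
  exact congrArg₂ _ (LinearMap.congr_fun h2 _) (LinearMap.congr_fun h0 _)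

/-! ### The coproduct of the half-ribbon element on the tensor square -/

/-- The tensor product of two endomorphisms of `V_ω`. -/
def tensorEnd (f g : Module.End K4 (irrep 1).V) :
    Module.End K4 ((irrep 1).tensor (irrep 1)).V := TensorProduct.map f g

lemma tensorEnd_tvec (a b c d a' b' c' d' x y z w : K4) :
    tensorEnd (mat1 a b c d) (mat1 a' b' c' d') (tvec x y z w) =
      tvec (a * (a' * x + b' * y) + b * (a' * z + b' * w))
        (a * (c' * x + d' * y) + b * (c' * z + d' * w))
        (c * (a' * x + b' * y) + d * (a' * z + b' * w))
        (c * (c' * x + d' * y) + d * (c' * z + d' * w)) := by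
  refine (map_tvec _ _ _ _ _).trans ?_
  change mat1 a b c d _ ⊗ₜ[K4] mat1 a' b' c' d' _ + mat1 a b c d _ ⊗ₜ[K4] mat1 a' b' c' d' _ = _
  simp only [mat1_vec1, vec1_tmul_vec1]
  refine (tvec_add ..).trans ?_
  congr 1 <;> ring

/-- The action of `X` on the tensor square of `V_ω`. -/
def deltaX : Module.End K4 ((irrep 1).tensor (irrep 1)).V :=
  -- The entries are those forced by `X_two` on the copy of `V_(2 ω)` and by `X_zero` on the trivial
  -- summand.
  q ^ 2 • tensorEnd (mat1 0 0 1 0) (mat1 0 0 1 0) +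
  q ^ 2 • tensorEnd (mat1 0 1 0 0) (mat1 0 1 0 0) +
  (-q) • tensorEnd (mat1 0 0 1 0) (mat1 0 1 0 0) +
  (-q) • tensorEnd (mat1 0 1 0 0) (mat1 0 0 1 0) +
  (1 - q ^ 2) • tensorEnd (mat1 0 0 0 1) (mat1 1 0 0 0)

lemma deltaX_tvec (a b c d : K4) :
    deltaX (tvec a b c d) = tvec (q ^ 2 * d) (-q * c) ((1 - q ^ 2) * c - q * b) (q ^ 2 * a) := by
  simp only [deltaX, LinearMap.add_apply, LinearMap.smul_apply, tensorEnd_tvec, tvec_smul,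
    tvec_add]
  congr 1 <;> ring

/-- The candidate `deltaX` restricts to `X 2` and `X 0` on the two summands. No other irreducible
maps nontrivially to the tensor square, so this gives compatibility, and spanning gives equality. -/
lemma comul_X_one_one : X.comul 1 1 = deltaX := by
  have h2 : deltaX ∘ₗ symHom.1 = symHom.1 ∘ₗ X 2 := by
    ext x
    obtain ⟨a, b, c, rfl⟩ := vec2_surj x
    change deltaX (symHom.1 _) = symHom.1 (X 2 _)
    rw [X_two, symHom_vec2, symHom_vec2, deltaX_tvec, tvec_inj]
    have := q_ne_zero
    refine ⟨rfl, ?_, ?_, rfl⟩ <;> field_simp <;> ring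
  have h0 : deltaX ∘ₗ trivHom.1 = trivHom.1 ∘ₗ X 0 := by
    ext x
    obtain ⟨a, rfl⟩ := vec_zero_surj x
    rw [X_zero]
    change deltaX (trivHom.1 _) = trivHom.1 _
    rw [map_smul, map_smul, trivHom_vec]
    congr 1
    rw [deltaX_tvec, tvec_inj]
    exact ⟨by ring, by ring, by ring, by ring⟩
  have hspec := UHat.act_spec (A := X) (W := (irrep 1).tensor (irrep 1)) deltaX fun n φ => by
    by_cases hn2 : n = 2
    · subst hn2
      obtain ⟨a, ha⟩ := hom_tensor_two φ
      rw [ha]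
      rw [LinearMap.comp_smul, h2, LinearMap.smul_comp]
    · by_cases hn0 : n = 0
      · subst hn0
        obtain ⟨a, ha⟩ := hom_tensor_zero φ
        rw [ha]
        rw [LinearMap.comp_smul, h0, LinearMap.smul_comp]
      · rw [hom_tensor_of_ne hn0 hn2 φ, LinearMap.zero_comp, LinearMap.comp_zero]
  exact hom_ext_of_summands ((hspec 2 symHom).trans h2.symm) ((hspec 0 trivHom).trans h0.symm)

/-! ### The R-matrix on the tensor square of the standard representation -/

lemma tvec_hom_ext {V : Type*} [AddCommGroup V] [Module K4 V]
    {f g : ((irrep 1).tensor (irrep 1)).V →ₗ[K4] V}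
    (h : ∀ a b c d, f (tvec a b c d) = g (tvec a b c d)) : f = g := by
  ext x
  obtain ⟨a, b, c, d, rfl⟩ := tvec_surj x
  exact h a b c d

/-- This is `q^(H ⊗ H / 2) (1 + (q - q⁻¹) E ⊗ F)` on `V_ω ⊗ V_ω`. It is written as a sum of pure
tensors so that the swap, `S ⊗ id` and `μ` apply term by term. -/
lemma R_one_one : R 1 1 =
    (s ^ 2 • tensorEnd (mat1 1 0 0 0) (mat1 1 0 0 0) +
    s ^ 2 • tensorEnd (mat1 0 0 0 1) (mat1 0 0 0 1) +
    (s ^ 2)⁻¹ • tensorEnd (mat1 1 0 0 0) (mat1 0 0 0 1) +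
    (s ^ 2)⁻¹ • tensorEnd (mat1 0 0 0 1) (mat1 1 0 0 0) +
    ((s ^ 2)⁻¹ * (q - q⁻¹)) • tensorEnd (mat1 0 1 0 0) (mat1 0 0 1 0)) := by
  have h : R 1 1 = UHat.tmul X.inv X.inv 1 1 * X.comul 1 1 := rfl
  rw [h, comul_X_one_one]
  change tensorEnd (X.inv 1) (X.inv 1) * deltaX = _
  rw [X_inv_one]
  refine tvec_hom_ext fun a b c d => ?_
  simp only [Module.End.mul_apply, deltaX_tvec, LinearMap.add_apply, LinearMap.smul_apply,
    tensorEnd_tvec, tvec_smul, tvec_add, q]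
  have := s_ne_zero
  rw [tvec_inj]
  refine ⟨?_, ?_, ?_, ?_⟩ <;> field_simp <;> ring

/-- The exchange of the two tensor factors on the endomorphisms of `V_ω ⊗ V_ω`. -/
def swapEnd : Module.End K4 ((irrep 1).tensor (irrep 1)).V →ₗ[K4]
    Module.End K4 ((irrep 1).V ⊗[K4] (irrep 1).V) :=
  (TensorProduct.comm K4 (irrep 1).V (irrep 1).V).conj.toLinearMap

lemma swapEnd_tensorEnd (f g : Module.End K4 (irrep 1).V) :
    swapEnd (tensorEnd f g) = TensorProduct.map g f :=
  TensorProduct.ext' fun _ _ => rfl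

lemma R_swap_one_one : R.swap 1 1 =
    s ^ 2 • TensorProduct.map (mat1 1 0 0 0) (mat1 1 0 0 0) +
    s ^ 2 • TensorProduct.map (mat1 0 0 0 1) (mat1 0 0 0 1) +
    (s ^ 2)⁻¹ • TensorProduct.map (mat1 0 0 0 1) (mat1 1 0 0 0) +
    (s ^ 2)⁻¹ • TensorProduct.map (mat1 1 0 0 0) (mat1 0 0 0 1) +
    ((s ^ 2)⁻¹ * (q - q⁻¹)) • TensorProduct.map (mat1 0 0 1 0) (mat1 0 1 0 0) := by
  have h : R.swap 1 1 = swapEnd (R 1 1) := TensorProduct.ext' fun _ _ => rfl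
  rw [h, R_one_one]
  simp only [map_add, map_smul, swapEnd_tensorEnd]

/-! ### The self-duality of the standard representation -/

/-- An element of the dual representation, as a linear form. -/
def Rep.form {W : Rep} (f : W.dual.V) : Module.Dual K4 W.V := f

/-- The invariant bilinear form on `V_ω`, as a map to the dual space. -/
def formMap : (irrep 1).V →ₗ[K4] (irrep 1).dual.V :=
  coord0.smulRight coord1 - q⁻¹ • coord1.smulRight coord0

lemma formMap_apply (a b c d : K4) :
    Rep.form (formMap (vec1 a b)) (vec1 c d) = a * d - q⁻¹ * (b * c) := rfl

lemma formMap_injective : Function.Injective formMap := by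
  rw [← LinearMap.ker_eq_bot, LinearMap.ker_eq_bot']
  intro x hx
  obtain ⟨a, b, rfl⟩ := vec1_surj x
  have h1 := formMap_apply a b 0 1
  have h2 := formMap_apply a b 1 0
  rw [hx] at h1 h2
  change (0 : K4) = _ at h1
  change (0 : K4) = _ at h2
  have hq := inv_ne_zero q_ne_zero
  have ha : a = 0 := by simpa using h1.symm
  have hb : b = 0 := by simpa [hq, q_ne_zero] using h2
  rw [ha, hb, vec1_zero]

lemma dual_act (W : Rep) (x : Uq) (f : W.dual.V) (v : W.V) :
    Rep.form (W.dual.ρ x f) v = Rep.form f (W.ρ (Uq.antipode x) v) := rfl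

lemma antipode_E : Uq.antipode Uq.E = -(Uq.E * Uq.K (-2)) := by
  simp [Uq.antipode, Uq.antipodeOp]

lemma antipode_F : Uq.antipode Uq.F = -(Uq.K 2 * Uq.F) := by
  simp [Uq.antipode, Uq.antipodeOp]

lemma antipode_K (n : ℤ) : Uq.antipode (Uq.K n) = Uq.K (-n) := by
  simp [Uq.antipode, Uq.antipodeOp]

lemma dual_ext {f g : (irrep 1).dual.V}
    (h : ∀ a b, Rep.form f (vec1 a b) = Rep.form g (vec1 a b)) : f = g :=
  vec1_hom_ext h

/-- The isomorphism of `V_ω` with its dual given by the invariant bilinear form. -/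
def formHom : (irrep 1).Hom (irrep 1).dual :=
  Rep.Hom.ofGens formMap
    (fun x => by
      obtain ⟨a, b, rfl⟩ := vec1_surj x
      refine dual_ext fun c d => ?_
      rw [dual_act, antipode_E, map_neg, LinearMap.neg_apply, map_mul, Module.End.mul_apply,
        K_vec1, E_vec1, E_vec1, map_neg, formMap_apply, formMap_apply]
      have : s ^ 4 = q := rfl
      have hq := q_ne_zero
      simp [this]
      field_simp)
    (fun x => by
      obtain ⟨a, b, rfl⟩ := vec1_surj x
      refine dual_ext fun c d => ?_
      rw [dual_act, antipode_F, map_neg, LinearMap.neg_apply, map_mul, Module.End.mul_apply,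
        F_vec1, F_vec1, K_vec1, map_neg, formMap_apply, formMap_apply, zpow_neg]
      have : s ^ (2 * 2 : ℤ) = q := by norm_cast
      rw [this]
      ring)
    (fun r x => by
      obtain ⟨a, b, rfl⟩ := vec1_surj x
      refine dual_ext fun c d => ?_
      rw [dual_act, antipode_K, K_vec1, K_vec1, formMap_apply, formMap_apply, mul_neg, neg_neg]
      ring)

/-- The invariant bilinear form on `V_ω` as a linear isomorphism. -/
def formEquiv : (irrep 1).V ≃ₗ[K4] (irrep 1).dual.V :=
  LinearMap.linearEquivOfInjective formMap formMap_injective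
    (Subspace.dual_finrank_eq (K := K4) (V := (irrep 1).V)).symm

lemma formEquiv_apply (x : (irrep 1).V) : formEquiv x = formMap x := rfl

/-- The isomorphism of representations between `V_ω` and its dual. -/
def formIso : (irrep 1).Iso (irrep 1).dual := ⟨formEquiv, formHom.2⟩

/-- Composing with the inverse of the invariant form reduces this to `hom_standard`. -/
lemma hom_dual {m : ℕ} (φ : (irrep m).Hom (irrep 1).dual) (hm : m ≠ 1) : φ.1 = 0 := by
  let ψ : (irrep m).Hom (irrep 1) := ⟨formEquiv.symm.toLinearMap ∘ₗ φ.1, fun x => by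
    ext v
    apply formEquiv.injective
    have h := LinearMap.congr_fun (formHom.2 x) (formEquiv.symm (φ.1 v))
    change formEquiv (formEquiv.symm (φ.1 _)) = formEquiv _
    rw [LinearEquiv.apply_symm_apply, φ.map_act]
    refine Eq.trans ?_ h.symm
    change _ = (irrep 1).dual.ρ x (formEquiv (formEquiv.symm (φ.1 v)))
    rw [LinearEquiv.apply_symm_apply]⟩
  have hψ := (hom_standard ψ).1 hm
  ext v
  apply formEquiv.symm.injective
  refine (LinearMap.congr_fun hψ v).trans ?_
  rw [LinearMap.zero_apply, LinearMap.zero_apply, map_zero]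

/-- Invariant forms are unique up to a scalar, because the kernel of `E` on the dual is the line of
the image of `v_+`. Hence the indicator does not depend on the chosen isomorphism. -/
lemma hom_dual_one (φ : (irrep 1).Hom (irrep 1).dual) : ∃ a : K4, φ.1 = a • formMap := by
  have hE := φ.E_highest
  have hd : ∀ f : (irrep 1).dual.V, (irrep 1).dual.ρ Uq.E f = 0 →
      ∃ a : K4, f = a • formMap (vec1 1 0) := by
    intro f hf
    obtain ⟨x, rfl⟩ := formEquiv.surjective f
    obtain ⟨a, b, rfl⟩ := vec1_surj x
    have h := LinearMap.congr_fun (formHom.2 Uq.E) (vec1 a b)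
    have h' : formMap ((irrep 1).ρ Uq.E (vec1 a b)) = 0 := h.trans hf
    rw [E_vec1] at h'
    have := formMap_injective (h'.trans (map_zero formMap).symm)
    rw [← vec1_zero, vec1_inj] at this
    refine ⟨a, ?_⟩
    rw [formEquiv_apply, this.1, ← map_smul, vec1_smul, mul_one, mul_zero]
  obtain ⟨a, ha⟩ := hd _ hE
  refine ⟨a, φ.eq_smul formHom a ?_⟩
  rw [ha, vec_one_zero]
  rfl

/-! ### The Drinfeld element on the standard representation -/

/-- The form identifies the dual with `V_ω`, so the action is that on `V_ω ⊗ V_ω`, transported.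
Every pair `φ`, `ψ` gives zero or a multiple of `formHom ⊗ id`, so compatibility is checked on that
map alone; as it is surjective, the action is also unique. -/
lemma act_dual_standard (A : UHat2) :
    A.act (irrep 1).dual (irrep 1) =
      TensorProduct.map formEquiv.toLinearMap LinearMap.id ∘ₗ A 1 1 ∘ₗ
        TensorProduct.map formEquiv.symm.toLinearMap LinearMap.id := by
  set B := TensorProduct.map formEquiv.toLinearMap LinearMap.id ∘ₗ A 1 1 ∘ₗ
        TensorProduct.map formEquiv.symm.toLinearMap LinearMap.id with hB
  have hB1 : B ∘ₗ TensorProduct.map formHom.1 (Rep.Hom.id (irrep 1)).1 =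
      TensorProduct.map formHom.1 (Rep.Hom.id (irrep 1)).1 ∘ₗ A 1 1 := by
    have : TensorProduct.map formEquiv.symm.toLinearMap LinearMap.id ∘ₗ
        TensorProduct.map formHom.1 (Rep.Hom.id (irrep 1)).1 = LinearMap.id := by
      rw [← TensorProduct.map_comp, ← TensorProduct.map_id]
      congr 1
      ext x
      exact formEquiv.symm_apply_apply x
    rw [hB, LinearMap.comp_assoc, LinearMap.comp_assoc, this, LinearMap.comp_id]
    rfl
  have hspec := UHat2.act_spec (A := A) B fun m n φ ψ => by
    by_cases hm : m = 1
    · by_cases hn : n = 1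
      · subst hm hn
        obtain ⟨a, ha⟩ := hom_dual_one φ
        obtain ⟨b, hb⟩ := hom_standard_one ψ
        rw [ha, hb, TensorProduct.map_smul_left, TensorProduct.map_smul_right,
          LinearMap.comp_smul, LinearMap.comp_smul, LinearMap.smul_comp, LinearMap.smul_comp]
        exact congrArg _ (congrArg _ hB1)
      · rw [(hom_standard ψ).1 hn, TensorProduct.map_zero_right, LinearMap.comp_zero,
          LinearMap.zero_comp]
    · rw [hom_dual φ hm, TensorProduct.map_zero_left, LinearMap.comp_zero, LinearMap.zero_comp]
  have h := (hspec 1 1 formHom (Rep.Hom.id _)).trans hB1.symm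
  refine TensorProduct.ext' fun f y => ?_
  obtain ⟨x, rfl⟩ := formEquiv.surjective f
  exact LinearMap.congr_fun h (x ⊗ₜ y)

lemma toEndTensor_map (V W : Type) [AddCommGroup V] [Module K4 V] [Module.Finite K4 V]
    [AddCommGroup W] [Module K4 W] [Module.Finite K4 W] (f : Module.End K4 V)
    (g : Module.End K4 W) : UHat2.toEndTensor V W (TensorProduct.map f g) = f ⊗ₜ g := by
  change (homTensorHomEquiv K4 V W V W).symm _ = _
  rw [LinearEquiv.symm_apply_eq, homTensorHomEquiv_apply, TensorProduct.homTensorHomMap_apply]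

lemma transposeBack_eq {V : Type} [AddCommGroup V] [Module K4 V] [Module.Finite K4 V]
    (β : Module.End K4 (Module.Dual K4 V)) (γ : Module.End K4 V)
    (h : ∀ f v, f (γ v) = β f v) : UHat2.transposeBack V β = γ := by
  ext v
  apply (Module.evalEquiv K4 V).injective
  ext f
  simp only [UHat2.transposeBack, LinearMap.comp_apply, LinearEquiv.coe_coe, LinearEquiv.conj_apply,
    LinearEquiv.symm_symm, LinearEquiv.apply_symm_apply, Module.evalEquiv_apply,
    Module.Dual.eval_apply, h]
  rfl

/-- The invariant bilinear form on `V_ω` as an isomorphism with the dual space. -/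
def formDual : (irrep 1).V ≃ₗ[K4] Module.Dual K4 (irrep 1).V := formEquiv

lemma formDual_apply (a b c d : K4) :
    formDual (vec1 a b) (vec1 c d) = a * d - q⁻¹ * (b * c) := rfl

/-- By invariance of the form, `S` sends a matrix to its adjoint: `B(x, S(M) y) = B(M x, y)`. The
adjoint exchanges the diagonal entries and rescales the others by `-q` and `-q⁻¹`. -/
lemma transposeBack_conj (a b c d : K4) :
    UHat2.transposeBack (irrep 1).V
      (formDual.toLinearMap ∘ₗ mat1 a b c d ∘ₗ formDual.symm.toLinearMap) =
      mat1 d (-q * b) (-q⁻¹ * c) a := by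
  refine transposeBack_eq _ _ fun f v => ?_
  obtain ⟨x, rfl⟩ := formDual.surjective f
  obtain ⟨x, y, rfl⟩ := vec1_surj x
  obtain ⟨z, w, rfl⟩ := vec1_surj v
  change _ = formDual (mat1 a b c d (formDual.symm (formDual _))) _
  rw [LinearEquiv.symm_apply_apply, mat1_vec1, mat1_vec1, formDual_apply, formDual_apply]
  have := q_ne_zero
  field_simp
  ring

/-- The linear map `μ (S ⊗ id)` on the endomorphisms of `V_ω ⊗ V_ω`. -/
def mulAntipode : Module.End K4 ((irrep 1).V ⊗[K4] (irrep 1).V) →ₗ[K4]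
    Module.End K4 (irrep 1).V :=
  LinearMap.mul' K4 (Module.End K4 (irrep 1).V) ∘ₗ
    TensorProduct.map (UHat2.transposeBack (irrep 1).V) LinearMap.id ∘ₗ
    UHat2.toEndTensor (Module.Dual K4 (irrep 1).V) (irrep 1).V ∘ₗ
    (TensorProduct.congr formDual (LinearEquiv.refl K4 (irrep 1).V)).conj.toLinearMap

lemma mul_antipodeLeft_one (A : UHat2) : A.antipodeLeft.mul 1 = mulAntipode (A 1 1) := by
  have h : A.antipodeLeft.mul 1 = LinearMap.mul' K4 (Module.End K4 (irrep 1).V)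
      (TensorProduct.map (UHat2.transposeBack (irrep 1).V) LinearMap.id
        (UHat2.toEndTensor (irrep 1).dual.V (irrep 1).V
          (A.act (irrep 1).dual (irrep 1)))) :=
    -- `UHat2.mul` starts by undoing the equivalence with which `UHat2.antipodeLeft` ends.
    congrArg (LinearMap.mul' K4 _) (LinearEquiv.symm_apply_apply _ _)
  rw [h, act_dual_standard]
  rfl

lemma mulAntipode_map (a b c d : K4) (g : Module.End K4 (irrep 1).V) :
    mulAntipode (TensorProduct.map (mat1 a b c d) g) = mat1 d (-q * b) (-q⁻¹ * c) a * g := by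
  have h : (TensorProduct.congr formDual (LinearEquiv.refl K4 (irrep 1).V)).conj
      (TensorProduct.map (mat1 a b c d) g) = TensorProduct.map
        (formDual.toLinearMap ∘ₗ mat1 a b c d ∘ₗ formDual.symm.toLinearMap) g :=
    TensorProduct.ext' fun _ _ => rfl
  rw [mulAntipode, LinearMap.comp_apply, LinearMap.comp_apply, LinearMap.comp_apply,
    LinearEquiv.coe_coe, h, toEndTensor_map, TensorProduct.map_tmul, transposeBack_conj,
    LinearMap.mul'_apply, LinearMap.id_apply]

/-- The two `s²` terms vanish, since `S` exchanges the diagonal idempotents. The two diagonal `s⁻²`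
terms give `s⁻²` times the identity, and the nilpotent term lowers the entry at `v_-` to `s⁻² (1 -
q⁻¹ (q - q⁻¹)) = s⁻¹⁰`. -/
lemma u_one : u 1 = mat1 (s ^ 2)⁻¹ 0 0 (s ^ 10)⁻¹ := by
  rw [u, mul_antipodeLeft_one, R_swap_one_one]
  simp only [map_add, map_smul, mulAntipode_map, mat1_mul, mat1_smul, mat1_add, q]
  have := s_ne_zero
  congr 1 <;> field_simp <;> ring

/-! ### Frobenius–Schur indicators -/

/-- For this `g` one has `B(y, g x) = c · B(x, y)`, so `c` satisfies the defining equation because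
`c² = 1`. -/
lemma FS_standard {v : UHat} {c : K4} (hc : c ^ 2 = 1)
    (hg : grouplike v 1 = mat1 (-c * q) 0 0 (-c * q⁻¹)) : FS v (irrep 1) = c := by
  have hne : Nonempty ((irrep 1).Iso (irrep 1).dual) := ⟨formIso⟩
  rw [FS, dif_pos hne]
  -- Nothing is known about the chosen isomorphism except that it is a nonzero multiple `a` of the
  -- invariant form; the factor `a` cancels.
  generalize Classical.choice hne = f
  obtain ⟨a, ha⟩ := hom_dual_one ⟨f.1.toLinearMap, f.2⟩
  change f.1.toLinearMap = a • formMap at ha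
  have ha0 : a ≠ 0 := by
    rintro rfl
    rw [zero_smul] at ha
    have h1 := LinearMap.congr_fun ha (vec1 1 0)
    have h2 : f.1 (vec1 1 0) = f.1 0 := h1.trans (map_zero f.1).symm
    have h3 := f.1.injective h2
    rw [← vec1_zero, vec1_inj] at h3
    exact one_ne_zero h3.1
  have key : ∀ x y z w : K4,
      Rep.form (W := irrep 1) ((f.1.toLinearMap.dualMap ∘ₗ pivotal v (irrep 1)) (vec1 x y))
        (vec1 z w) = c * (a * (x * w - q⁻¹ * (y * z))) := fun x y z w => by
    change Rep.form (f.1.toLinearMap (vec1 z w))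
      ((grouplike v).act (irrep 1) (vec1 x y)) = _
    rw [ha, UHat.act_standard, hg, mat1_vec1]
    change a * Rep.form (formMap (vec1 z w)) _ = _
    rw [formMap_apply]
    have := q_ne_zero
    field_simp
    ring
  have hex : f.1.toLinearMap = c • (f.1.toLinearMap.dualMap ∘ₗ pivotal v (irrep 1)) := by
    refine vec1_hom_ext fun x y => dual_ext fun z w => ?_
    change _ = c * Rep.form (W := irrep 1)
      ((f.1.toLinearMap.dualMap ∘ₗ pivotal v (irrep 1)) (vec1 x y)) (vec1 z w)
    rw [key, ha]
    change a * Rep.form (formMap (vec1 x y)) _ = _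
    rw [formMap_apply]
    linear_combination -(a * (x * w - q⁻¹ * (y * z))) * hc
  have hspec := Classical.epsilon_spec (p := fun c : K4 =>
    f.1.toLinearMap = c • (f.1.toLinearMap.dualMap ∘ₗ pivotal v (irrep 1))) ⟨c, hex⟩
  suffices huniq : ∀ c' : K4,
      f.1.toLinearMap = c' • (f.1.toLinearMap.dualMap ∘ₗ pivotal v (irrep 1)) → c' = c from
    huniq _ hspec
  intro c' hc'
  -- The constant is unique: at the pair `v_+`, `v_-` the map `f* ∘ p` has the value `c · a ≠ 0`,
  -- which can be cancelled.
  have h := hex.symm.trans hc'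
  have h1 := congrArg (fun φ : (irrep 1).V →ₗ[K4] (irrep 1).dual.V =>
    Rep.form (φ (vec1 1 0)) (vec1 0 1)) h
  change c * Rep.form (W := irrep 1)
      ((f.1.toLinearMap.dualMap ∘ₗ pivotal v (irrep 1)) (vec1 1 0)) (vec1 0 1) =
    c' * Rep.form (W := irrep 1)
      ((f.1.toLinearMap.dualMap ∘ₗ pivotal v (irrep 1)) (vec1 1 0)) (vec1 0 1) at h1
  rw [key] at h1
  have hc0 : c ≠ 0 := by rintro rfl; simp at hc
  refine (mul_right_cancel₀ ?_ h1).symm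
  simp [hc0, ha0]

lemma C_one : C 1 = mat1 (s ^ 6)⁻¹ 0 0 (s ^ 6)⁻¹ := by
  rw [C, ← mat1_one, mat1_smul]
  norm_num

lemma C_inv_one : C.inv 1 = mat1 (s ^ 6) 0 0 (s ^ 6) := by
  have := s_ne_zero
  rw [UHat.inv, C_one]
  apply inverse_mat1 <;> rw [mat1_mul, ← mat1_one] <;> congr 1 <;> simp [this]

/-- Compared with `C_one`, the two ribbon elements are negatives of each other on `V_ω`, and so are
the resulting indicators. -/
lemma XInvSq_one : XInvSq 1 = mat1 (-(s ^ 6)⁻¹) 0 0 (-(s ^ 6)⁻¹) := by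
  change X.inv 1 ^ 2 = _
  have := s_ne_zero
  rw [X_inv_one, sq, mat1_mul]
  congr 1 <;> field_simp <;> ring

lemma XInvSq_inv_one : XInvSq.inv 1 = mat1 (-s ^ 6) 0 0 (-s ^ 6) := by
  have := s_ne_zero
  rw [UHat.inv, XInvSq_one]
  apply inverse_mat1 <;> rw [mat1_mul, ← mat1_one] <;> congr 1 <;> simp [this]

lemma grouplike_C_one : grouplike C 1 = mat1 q 0 0 q⁻¹ := by
  change C.inv 1 * u 1 = _
  have := s_ne_zero
  rw [C_inv_one, u_one, mat1_mul, q]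
  congr 1 <;> field_simp <;> ring

lemma grouplike_XInvSq_one : grouplike XInvSq 1 = mat1 (-q) 0 0 (-q⁻¹) := by
  change XInvSq.inv 1 * u 1 = _
  have := s_ne_zero
  rw [XInvSq_inv_one, u_one, mat1_mul, q]
  congr 1 <;> field_simp <;> ring

end QuantumSl2

end

theorem mainTheorem11 :
    QuantumSl2.FS QuantumSl2.C QuantumSl2.standardRep = -1 ∧
      QuantumSl2.FS QuantumSl2.XInvSq QuantumSl2.standardRep = 1 := by
  constructor
  · refine QuantumSl2.FS_standard (by norm_num) ?_
    rw [QuantumSl2.grouplike_C_one]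
    simp
  · refine QuantumSl2.FS_standard (by norm_num) ?_
    rw [QuantumSl2.grouplike_XInvSq_one]
    simp
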